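/- **Optimal play on strongly connected graphs.** *The game.* Let $\mathcal G=(\mathcal V,\mathcal E)$ be a finite digraph (loops allowed) that is strongly connected and aperiodic (the gcd of the lengths of its cycles is $1$); let $n_i$ be the out-degree of $i$. In each round, at the current node $i$, the Guesser guesses an out-neighbour of $i$ (possibly at random) and announces a wager, a proportion $w\in[0,1]$ of her current fortune; the Chooser, knowing the wager but not the guess, moves (possibly at random, independently of the guess) to an out-neighbour of $i$. If the guess is wrong, the Guesser loses her wager; if it is right, she receives $n_i-1$ times her wager when $n_i\ge 2$, and her wager when $n_i=1$. Play goes on forever. $X_t$ is the position and $F_t$ the Guesser's fortune after $t$ rounds, $F_0=1$. The Guesser maximizes and the Chooser minimizes expected fortunes. Strategies may depend on the whole past; they are positional if they depend only on the current node. A saddle point of a payoff is a pair of strategies from which neither player gains by deviating. *Values.* The propagation matrix $M$ has $M_{ij}=1/2$ if $n_i=1$ and $i\to j$, $M_{ij}=1/n_i$ if $n_i\ge2$ and $i\to j$, and $M_{ij}=0$ otherwise. Then $M$ is primitive; it has an eigenvalue $r>0$ such that every other complex eigenvalue $\lambda$ satisfies $|\lambda|<r$; the limit $u=\lim_{s\to\infty}r^{-s}M^s\mathbf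 1$ exists, is strictly positive, and satisfies $Mu=ru$; and if $Mx=zx$ with $z$ real and $x$ strictly positive, then $z=r$ and $x$ is a positive multiple of $u$. *Limiting strategies.* Put $c_{ij}=1$ if $n_i=1$ and $i\to j$; $c_{ij}=u_j/\sum_{k:i\to k}u_k$ if $n_i\ge2$ and $i\to j$; $c_{ij}=0$ otherwise; and $c_{i,\min}=\min\{c_{ij}: i\to j\}$. The Chooser's limiting strategy is to move from $i$ to $j$ with probability $c_{ij}$. For parameters $\beta_i\in[0,1]$ (for instance all equal to one $\beta$), the Guesser's limiting strategy is, at a node with $n_i=1$, to guess the only out-neighbour and wager $w_i=1$; and at a node with $n_i\ge2$, to wager $w_i=1-n_i\beta_ic_{i,\min}$ and to guess $j$ (where $i\to j$) with probability $$g_{ij}=\frac{c_{ij}-\beta_ic_{i,\min}}{1-n_i\beta_ic_{i,\min}},$$ the guess being arbitrary if $w_i=0$. *Optimality.* A pair of positional strategies is called optimal for the game discounted by $d>0$, with node values $v_i>0$, if $\lim_{t\to\infty}d^tE[F_t\mid X_0=i]=v_i$ for all $i$ and if at each node $i$ the players' strategies form a saddle point of the one-round game at $i$ in which the Guesser's fortune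 after the round is multiplied by $d\,v_k$, where $k$ is the node the Chooser moved to. **Theorem.** The limiting strategies exist (for every choice of the $\beta_i$), and $(c_{ij})=r^{-1}\,\mathrm{diag}(u)^{-1}M\,\mathrm{diag}(u)$. There is a constant $\kappa>0$, depending only on $\mathcal G$, such that, with $v_i=\kappa/u_i$, the following holds. 1. The limiting strategies, for every choice of the $\beta_i\in[0,1]$, are optimal for the infinite-duration game discounted by $r$, with node values $v_i$. In particular $\lim_t r^tE[F_t\mid X_0=i]=v_i$ under them. 2. They are a saddle point among all history-dependent strategies (the Guesser's wager being a function of the past): for every $s\ge0$ and every initial node $i$, for the payoff $r^sE[F_s\,v_{X_s}\mid X_0=i]$, where the value of the game is $v_i$; and for both growth rates $\limsup_t E[F_t\mid X_0=i]^{1/t}$ and $\liminf_t E[F_t\mid X_0=i]^{1/t}$ of the undiscounted infinite-duration game, where the value of the game is $1/r$. 3. The optimal values and strategies are unique: if a pair of positional strategies is optimal for the game discounted by some $d>0$, with node values $v'_i>0$, then $d=r$, $v'=v$, the Chooser plays his limiting strategy, and the Guesser plays one of her limiting strategies, for some $\beta_i\in[0,1]$. -/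

import Mathlib

open Filter Topology Set

noncomputable section

namespace PathGame

variable {V : Type*}

/-! ### Digraphs (loops are allowed, multiple edges are not) -/

/-- Every vertex can be reached from every vertex along directed edges. -/
def StronglyConnected (G : Digraph V) : Prop :=
  ∀ i j : V, Relation.ReflTransGen G.Adj i j

/-- There is a directed cycle (closed walk) of length `n ≥ 1` in `G`. -/
def HasCycle (G : Digraph V) (n : ℕ) : Prop :=
  0 < n ∧ ∃ x : ℕ → V, x 0 = x n ∧ ∀ k < n, G.Adj (x k) (x (k + 1))

/-- The greatest common divisor of the lengths of all cycles is `1`. -/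
def Aperiodic (G : Digraph V) : Prop :=
  ∀ d : ℕ, (∀ n, HasCycle G n → d ∣ n) → d = 1

variable [Fintype V] [DecidableEq V] (G : Digraph V) [DecidableRel G.Adj]

/-- The out-degree `n_i`. -/
def outDeg (i : V) : ℕ := (Finset.univ.filter (fun j => G.Adj i j)).card

/-- The propagation matrix `M`. -/
def propMatrix : Matrix V V ℝ := Matrix.of fun i j =>
  if G.Adj i j then (if outDeg G i = 1 then 1 / 2 else 1 / (outDeg G i : ℝ)) else 0

/-- `r > 0` is an eigenvalue of the real matrix `M`, and every other complex eigenvalue of `M` is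
strictly smaller than `r` in absolute value. -/
def IsMaximalEigenvalue (M : Matrix V V ℝ) (r : ℝ) : Prop :=
  0 < r ∧
  Module.End.HasEigenvalue (Matrix.toLin' (M.map (fun a : ℝ => (a : ℂ)))) (r : ℂ) ∧
  ∀ z : ℂ, Module.End.HasEigenvalue (Matrix.toLin' (M.map (fun a : ℝ => (a : ℂ)))) z →
    z ≠ (r : ℂ) → ‖z‖ < r

/-! ### The rules of the game -/

/-- The payoff rule: the Guesser's fortune after one round at node `i`, if her fortune was `F`,
she wagered the amount `a` on the node `guess`, and the Chooser moved to the node `next`. -/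
def newFortune (i : V) (F a : ℝ) (guess next : V) : ℝ :=
  if guess = next then
    (if outDeg G i = 1 then F + a else F + ((outDeg G i : ℝ) - 1) * a)
  else F - a

/-- `p` is a probability distribution on the set of out-neighbours of `i`. -/
def IsMove (i : V) (p : V → ℝ) : Prop :=
  (∀ j, 0 ≤ p j) ∧ (∀ j, ¬ G.Adj i j → p j = 0) ∧ ∑ j, p j = 1

/-- The record of the past rounds, most recent round first. A round is recorded as
(node at which it was played, the Guesser's guess, the proportion of her fortune that she wagered);
the node the Chooser moved to is the node of the following round. -/
abbrev History (V : Type*) := List (V × V × ℝ)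

/-- A (history dependent, randomizing) strategy of the Chooser: the distribution of the next node,
given the past rounds, the current node, and the announced wager (as a proportion). -/
structure ChooserStrategy where
  prob : History V → V → ℝ → V → ℝ
  isMove : ∀ h i w, IsMove G i (prob h i w)

/-- A (history dependent) strategy of the Guesser: the distribution of the guess and the wager
(the proportion of the current fortune), given the past rounds and the current node. -/
structure GuesserStrategy where
  prob : History V → V → V → ℝ
  wager : History V → V → ℝ
  isMove : ∀ h i, IsMove G i (prob h i)
  wager_mem : ∀ h i, wager h i ∈ Icc (0 : ℝ) 1

/-- A purely positional strategy of the Chooser. -/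
structure PositionalChooser where
  prob : V → V → ℝ
  isMove : ∀ i, IsMove G i (prob i)

/-- A purely positional strategy of the Guesser. -/
structure PositionalGuesser where
  prob : V → V → ℝ
  wager : V → ℝ
  isMove : ∀ i, IsMove G i (prob i)
  wager_mem : ∀ i, wager i ∈ Icc (0 : ℝ) 1

variable {G}

/-- A positional strategy, as a strategy. -/
def PositionalChooser.toStrategy (c : PositionalChooser G) : ChooserStrategy G where
  prob _ i _ := c.prob i
  isMove _ i _ := c.isMove i

/-- A positional strategy, as a strategy. -/
def PositionalGuesser.toStrategy (g : PositionalGuesser G) : GuesserStrategy G where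
  prob _ i := g.prob i
  wager _ i := g.wager i
  isMove _ i := g.isMove i
  wager_mem _ i := g.wager_mem i

/-- The expectation of `F_t * f (X_t)`, where `F_t` and `X_t` are the Guesser's fortune and the
players' position after `t` further rounds, when the past rounds are `h`, the players are at `i`
and the Guesser's fortune is `F`. In each round the guess `j` and the next node `k` are drawn
independently from the players' current distributions. -/
def expPayoffFrom (τ : ChooserStrategy G) (σ : GuesserStrategy G) (f : V → ℝ) :
    ℕ → History V → V → ℝ → ℝ
  | 0, _, i, F => F * f i
  | t + 1, h, i, F =>
      ∑ j, ∑ k, σ.prob h i j * τ.prob h i (σ.wager h i) k *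
        expPayoffFrom τ σ f t ((i, j, σ.wager h i) :: h) k
          (newFortune G i F (σ.wager h i * F) j k)

/-- `E[F_t * f (X_t) | X_0 = i]`, the play starting at `i` with a fortune of one dollar. -/
def expPayoff (τ : ChooserStrategy G) (σ : GuesserStrategy G) (f : V → ℝ) (t : ℕ) (i : V) : ℝ :=
  expPayoffFrom τ σ f t [] i 1

/-- `E[F_t | X_0 = i]`. -/
def expFortune (τ : ChooserStrategy G) (σ : GuesserStrategy G) (t : ℕ) (i : V) : ℝ :=
  expPayoff τ σ (fun _ => 1) t i

/-- The upper exponential growth rate `limsup (E[F_t | X_0 = i]) ^ (1 / t)`. -/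
def upperGrowth (i : V) (τ : ChooserStrategy G) (σ : GuesserStrategy G) : ENNReal :=
  limsup (fun t : ℕ => ENNReal.ofReal (expFortune τ σ t i) ^ (1 / (t : ℝ))) atTop

/-- The lower exponential growth rate `liminf (E[F_t | X_0 = i]) ^ (1 / t)`. -/
def lowerGrowth (i : V) (τ : ChooserStrategy G) (σ : GuesserStrategy G) : ENNReal :=
  liminf (fun t : ℕ => ENNReal.ofReal (expFortune τ σ t i) ^ (1 / (t : ℝ))) atTop

variable (G)

/-! ### The one-round game at a node, and optimality in the discounted game -/

/-- The Chooser's mixed strategies in the one-round game at `i`. -/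
def fanChooser (i : V) : Set (V → ℝ) := {c | IsMove G i c}

/-- The Guesser's strategies (distribution of the guess, wager) in the one-round game at `i`. -/
def fanGuesser (i : V) : Set ((V → ℝ) × ℝ) := {s | IsMove G i s.1 ∧ s.2 ∈ Icc (0 : ℝ) 1}

/-- The Guesser's expected final fortune in the one-round game at `i` (the game on the fan whose
leaves are the out-neighbours `k` of `i`, with leaf values `a k`), starting with one dollar. -/
def fanPayoff (i : V) (a : V → ℝ) (c : V → ℝ) (s : (V → ℝ) × ℝ) : ℝ :=
  ∑ j, ∑ k, s.1 j * c k * (newFortune G i 1 s.2 j k * a k)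

variable {G}

/-- A positional pair of strategies is optimal for the infinite game discounted by `d`, with
finite nonzero node values `v`: the discounted expected fortunes `d ^ t * E[F_t | X_0 = i]`
converge to `v i`, and at each node `i` the players play a saddle point of the game on the fan
of `i` in which the leaf `k` has its discounted value `d * v k`. -/
def IsOptimalDiscounted (d : ℝ) (v : V → ℝ)
    (c : PositionalChooser G) (g : PositionalGuesser G) : Prop :=
  0 < d ∧ (∀ i, 0 < v i) ∧
  (∀ i, Tendsto (fun t : ℕ => d ^ t * expFortune c.toStrategy g.toStrategy t i) atTop (𝓝 (v i))) ∧
  ∀ i, IsSaddlePointOn (fanChooser G i) (fanGuesser G i) (fanPayoff G i (fun k => d * v k))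
    (c.prob i) (g.prob i, g.wager i)

/-! ### The limiting strategies of a vector `u` of reciprocal values -/

variable (G)

/-- The limiting transition probabilities `c_{ij}` of the Chooser. -/
def limitingProb (u : V → ℝ) (i j : V) : ℝ :=
  if G.Adj i j then
    (if outDeg G i = 1 then 1
      else u j / ∑ k ∈ Finset.univ.filter (fun k => G.Adj i k), u k)
  else 0

/-- `c_{i,min}`, the least of the limiting transition probabilities along an edge out of `i`. -/
def limitingProbMin (u : V → ℝ) (i : V) : ℝ :=
  sInf (limitingProb G u i '' {j | G.Adj i j})

variable {G}

/-- The limiting strategy of the Chooser. -/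
def IsLimitingChooser (u : V → ℝ) (c : PositionalChooser G) : Prop :=
  ∀ i j, c.prob i j = limitingProb G u i j

/-- The limiting strategies of the Guesser, with parameter `β i` at the node `i`. Where the wager
is `0` the formula for the guessing probabilities reads `0 / 0`, and the guess is arbitrary. -/
def IsLimitingGuesser (u : V → ℝ) (β : V → ℝ) (g : PositionalGuesser G) : Prop :=
  ∀ i,
    (outDeg G i = 1 → g.wager i = 1 ∧ ∀ j, G.Adj i j → g.prob i j = 1) ∧
    (2 ≤ outDeg G i →
      g.wager i = 1 - (outDeg G i : ℝ) * β i * limitingProbMin G u i ∧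
      (g.wager i ≠ 0 → ∀ j, G.Adj i j →
        g.prob i j = (limitingProb G u i j - β i * limitingProbMin G u i) /
          (1 - (outDeg G i : ℝ) * β i * limitingProbMin G u i)))

end PathGame

end

/-!
Write `N_i` for the factor by which a correct guess multiplies a fully wagered fortune at `i`: the
out-degree, or `2` where the out-degree is `1`. Then `M_{ij} = 1 / N_i` on every edge. If the
Guesser guesses with probabilities `g` and wagers `w`, and the Chooser moves to `k`, her expected
fortune is multiplied by `1 - w + N_i w g_k`.

*One round.* In the game on the fan of `i` with positive leaf values `a_k`, the Chooser equalizes by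
moving to `k` with probability proportional to `1 / a_k`, and the Guesser by making her multiplier
proportional to `1 / a_k`. Both secure the value `N_i / ∑ 1 / a_k`. Testing a saddle point against
pure moves of either player bounds its coordinates on one side; the sums of the bounds agree, so all
bounds are equalities (`fan_saddlePoint_unique`). With leaf values `d v_k` and value `v_i`, this
says that the reciprocals `1 / v` satisfy `M (1 / v) = d (1 / v)`.

*Perron theory.* All large numbers are lengths of closed walks at a node, so `M` is primitive
(`isPrimitive_of_period_one`). It has a positive eigenvector by a compactness argument
(`exists_pos_eigenvector`). Conjugating by this eigenvector yields a primitive stochastic matrix,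
whose powers contract the oscillation of every vector. Hence `r⁻ᵗ Mᵗ y` converges to a multiple of
`u` for every `y` (`tendsto_pow_mulVec`), from which the uniqueness of the positive eigenvector and
the dominance of `r` are read off.

*The infinite game.* The limiting strategies are the equalizing ones for `a_k = r κ / u_k`. Hence
`r^t F_t v_{X_t}` does not increase in expectation against the limiting Chooser and is constant in
expectation against the limiting Guesser, whatever the opponent does; since `v` is bounded above and
below, the growth rates follow. Under the limiting strategies
`r^t E[F_t | X_0 = i] = u_i⁻² (r⁻ᵗ Mᵗ u²)_i` (`expFortune_limiting`), which converges to `κ / u_i`,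
where `κ` is the coefficient of `u` in the limit of `r⁻ᵗ Mᵗ u²`. Conversely, the node values of any
optimal pair solve all one-round games, so their reciprocals form a positive eigenvector, and the
uniqueness of fan saddle points identifies the strategies. Being limiting strategies, they have the
discounted limit `κ / u_i`, which fixes the scale of the node values.
-/

namespace Matrix

/-! ### Positivity of matrix powers and primitivity -/

variable {V : Type*} [Fintype V]

lemma mulVec_pos_of_pos {B : Matrix V V ℝ} (hB : ∀ i j, 0 < B i j) {y : V → ℝ} (hy : ∀ i, 0 ≤ y i)
    (hy0 : y ≠ 0) (i : V) : 0 < (B *ᵥ y) i := by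
  obtain ⟨j, hj⟩ := Function.ne_iff.1 hy0
  exact Finset.sum_pos' (fun k _ => mul_nonneg (hB i k).le (hy k))
    ⟨j, Finset.mem_univ _, mul_pos (hB i j) (lt_of_le_of_ne (hy j) (Ne.symm hj))⟩

variable [DecidableEq V] {A : Matrix V V ℝ}

lemma pow_add_apply_pos (hA : ∀ i j, 0 ≤ A i j) {m n : ℕ} {i j k : V}
    (hm : 0 < (A ^ m) i j) (hn : 0 < (A ^ n) j k) : 0 < (A ^ (m + n)) i k := by
  rw [pow_add, mul_apply]
  exact Finset.sum_pos' (fun l _ => mul_nonneg (pow_apply_nonneg hA _ _ _)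
    (pow_apply_nonneg hA _ _ _)) ⟨j, Finset.mem_univ _, mul_pos hm hn⟩

lemma exists_pow_apply_pos_of_reflTransGen (hA : ∀ i j, 0 ≤ A i j) {R : V → V → Prop}
    (hR : ∀ i j, R i j → 0 < A i j) {i j : V} (h : Relation.ReflTransGen R i j) :
    ∃ n, 0 < (A ^ n) i j := by
  induction h with
  | refl => exact ⟨0, by simp⟩
  | tail _ hbc ih =>
    obtain ⟨n, hn⟩ := ih
    exact ⟨n + 1, pow_add_apply_pos hA hn (by simpa using hR _ _ hbc)⟩

lemma pow_apply_pos_of_walk (hA : ∀ i j, 0 ≤ A i j) (x : ℕ → V) (n : ℕ)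
    (hx : ∀ k < n, 0 < A (x k) (x (k + 1))) : 0 < (A ^ n) (x 0) (x n) := by
  induction n with
  | zero => simp
  | succ n ih =>
    exact pow_add_apply_pos hA (ih fun k hk => hx k (by omega)) (by simpa using hx n (by omega))

/-- A nonnegative irreducible matrix of period `1` is primitive. The lengths of the closed walks at
a node form an additive monoid with gcd `1`, which contains all large numbers; a walk between any
two nodes may be led through that node and prolonged there to any large length. -/
theorem isPrimitive_of_period_one (hA : ∀ i j, 0 ≤ A i j)
    (hirr : ∀ i j, ∃ n, 0 < (A ^ n) i j)
    (hper : ∀ d : ℕ, (∀ n i, 0 < (A ^ n) i i → d ∣ n) → d = 1) : A.IsPrimitive := by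
  refine ⟨hA, ?_⟩
  rcases isEmpty_or_nonempty V with hV | ⟨⟨o⟩⟩
  · exact ⟨1, one_pos, fun i => isEmptyElim i⟩
  choose a ha using hirr
  let S : AddSubmonoid ℕ :=
    { carrier := {n | 0 < (A ^ n) o o}
      zero_mem' := by simp
      add_mem' := fun hm hn => pow_add_apply_pos hA hm hn }
  have hgcd : Nat.setGcd (S : Set ℕ) = 1 := by
    refine hper _ fun n i hn => ?_
    have h0 : a o i + a i o ∈ S := pow_add_apply_pos hA (ha o i) (ha i o)
    have h1 : a o i + n + a i o ∈ S :=
      pow_add_apply_pos hA (pow_add_apply_pos hA (ha o i) hn) (ha i o)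
    have d0 := Nat.setGcd_dvd_of_mem h0
    have d1 := Nat.setGcd_dvd_of_mem h1
    rw [show a o i + n + a i o = (a o i + a i o) + n by ring] at d1
    exact (Nat.dvd_add_right d0).1 d1
  obtain ⟨N, hN⟩ := Nat.exists_mem_closure_of_ge (S : Set ℕ)
  have hS : ∀ m ≥ N, 0 < (A ^ m) o o := fun m hm => by
    have := hN m hm (hgcd ▸ one_dvd m)
    rwa [AddSubmonoid.closure_eq] at this
  refine ⟨N + ∑ i, a i o + ∑ i, a o i + 1, by omega, fun i j => ?_⟩
  have h1 : a i o ≤ ∑ i, a i o :=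
    Finset.single_le_sum (f := fun i => a i o) (fun _ _ => Nat.zero_le _) (Finset.mem_univ i)
  have h2 : a o j ≤ ∑ i, a o i :=
    Finset.single_le_sum (f := fun i => a o i) (fun _ _ => Nat.zero_le _) (Finset.mem_univ j)
  obtain ⟨m, hm⟩ : ∃ m, N + ∑ i, a i o + ∑ i, a o i + 1 = a i o + (N + m) + a o j :=
    ⟨∑ i, a i o + ∑ i, a o i + 1 - a i o - a o j, by omega⟩
  rw [hm]
  exact pow_add_apply_pos hA (pow_add_apply_pos hA (ha i o) (hS _ (by omega))) (ha o j)

lemma pow_mulVec_eigenvector {A : Matrix V V ℝ} {r : ℝ} {x : V → ℝ} (h : A *ᵥ x = r • x) (n : ℕ) :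
    (A ^ n) *ᵥ x = r ^ n • x := by
  induction n with
  | zero => simp
  | succ n ih => rw [pow_succ, ← mulVec_mulVec, h, mulVec_smul, ih, smul_smul, pow_succ']

/-! ### The Perron eigenvector -/

/-- A primitive matrix has a positive eigenvalue with a positive eigenvector. The largest `ρ` with
`ρ x ≤ A x` for some `x` of the simplex exists by compactness. If `ρ x ≠ A x`, a positive power of
`A` makes the inequality strict in all coordinates, so that `ρ` could be increased. -/
theorem IsPrimitive.exists_pos_eigenvector [Nonempty V] (hA : A.IsPrimitive) :
    ∃ (r : ℝ) (x : V → ℝ), 0 < r ∧ (∀ i, 0 < x i) ∧ A *ᵥ x = r • x := by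
  obtain ⟨hA0, k, hk, hpos⟩ := hA
  set R : ℝ := ∑ i, ∑ j, A i j with hR
  let K : Set (ℝ × (V → ℝ)) :=
    (Icc 0 R ×ˢ stdSimplex ℝ V) ∩ {p | ∀ i, p.1 * p.2 i ≤ (A *ᵥ p.2) i}
  have hKc : IsCompact K := by
    refine (isCompact_Icc.prod (isCompact_stdSimplex ℝ V)).inter_right ?_
    simp only [ofPred_forall]
    refine isClosed_iInter fun i => isClosed_le (by fun_prop) ?_
    simp only [mulVec, dotProduct]
    fun_prop
  -- the bound `R` on `ρ` holds for every vector of the simplex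
  have hbound : ∀ (ρ : ℝ) (x : V → ℝ), x ∈ stdSimplex ℝ V → (∀ i, ρ * x i ≤ (A *ᵥ x) i) →
      ρ ≤ R := by
    intro ρ x hx h
    calc ρ = ∑ i, ρ * x i := by rw [← Finset.mul_sum, hx.2, mul_one]
      _ ≤ ∑ i, (A *ᵥ x) i := Finset.sum_le_sum fun i _ => h i
      _ ≤ R := Finset.sum_le_sum fun i _ => Finset.sum_le_sum fun j _ =>
        mul_le_of_le_one_right (hA0 i j) (hx.2 ▸ Finset.single_le_sum
          (f := x) (fun l _ => hx.1 l) (Finset.mem_univ j))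
  have hR0 : 0 ≤ R := Finset.sum_nonneg fun i _ => Finset.sum_nonneg fun j _ => hA0 i j
  have hKne : K.Nonempty := by
    obtain ⟨x, hx⟩ : (stdSimplex ℝ V).Nonempty :=
      ⟨_, single_mem_stdSimplex ℝ (Classical.arbitrary V)⟩
    refine ⟨(0, x), ⟨⟨le_refl _, hR0⟩, hx⟩, fun i => ?_⟩
    simp only [zero_mul]
    exact Finset.sum_nonneg fun j _ => mul_nonneg (hA0 i j) (hx.1 j)
  obtain ⟨⟨ρ, x⟩, ⟨⟨hρ, hx⟩, hle⟩, hmax⟩ := hKc.exists_isMaxOn hKne continuous_fst.continuousOn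
  simp only at hρ hx hle
  have hx0 : x ≠ 0 := by
    rintro rfl
    simpa using hx.2
  have hBx := mulVec_pos_of_pos hpos hx.1 hx0
  have heig : A *ᵥ x = ρ • x := by
    by_contra hne
    set y : V → ℝ := A *ᵥ x - ρ • x with hy
    have hy0 : y ≠ 0 := sub_ne_zero.2 hne
    have hBy := mulVec_pos_of_pos hpos (y := y) (fun i => by simpa [hy] using hle i) hy0
    set z : V → ℝ := (A ^ k) *ᵥ x with hz
    have hzy : ∀ i, (A *ᵥ z) i = ρ * z i + ((A ^ k) *ᵥ y) i := by
      intro i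
      have : A *ᵥ z = ρ • z + (A ^ k) *ᵥ y := by
        rw [hy, mulVec_sub, mulVec_smul, hz, mulVec_mulVec, mulVec_mulVec, ← pow_succ, ← pow_succ']
        abel
      simp [this]
    -- a common positive lower bound of the ratios `(A ^ k y) i / z i`
    obtain ⟨i₀, hi₀⟩ := Finite.exists_min fun i => ((A ^ k) *ᵥ y) i / z i
    set ε : ℝ := ((A ^ k) *ᵥ y) i₀ / z i₀ with hε
    have hε0 : 0 < ε := div_pos (hBy i₀) (hBx i₀)
    have hεle : ∀ i, (ρ + ε) * z i ≤ (A *ᵥ z) i := by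
      intro i
      have := (le_div_iff₀ (hBx i)).1 (hi₀ i)
      rw [hzy]; linarith
    set s : ℝ := ∑ i, z i with hs
    have hs0 : 0 < s := Finset.sum_pos (fun i _ => hBx i) Finset.univ_nonempty
    have hz' : s⁻¹ • z ∈ stdSimplex ℝ V := by
      refine ⟨fun i => mul_nonneg (inv_nonneg.2 hs0.le) (hBx i).le, ?_⟩
      simp only [Pi.smul_apply, smul_eq_mul]
      rw [← Finset.mul_sum, inv_mul_cancel₀ hs0.ne']
    have hz'' : ∀ i, (ρ + ε) * (s⁻¹ • z) i ≤ (A *ᵥ (s⁻¹ • z)) i := by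
      intro i
      rw [mulVec_smul, Pi.smul_apply, Pi.smul_apply, smul_eq_mul, smul_eq_mul, mul_left_comm]
      exact mul_le_mul_of_nonneg_left (hεle i) (inv_nonneg.2 hs0.le)
    have : (ρ + ε, s⁻¹ • z) ∈ K :=
      ⟨⟨⟨by linarith [hρ.1], hbound _ _ hz' hz''⟩, hz'⟩, hz''⟩
    have := hmax this
    simp only [mem_ofPred_eq] at this
    linarith
  have hpow := pow_mulVec_eigenvector heig k
  have hprod : ∀ i, 0 < ρ ^ k * x i := fun i => by simpa [hpow] using hBx i
  have hρ0 : 0 < ρ := by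
    refine lt_of_le_of_ne hρ.1 fun h => ?_
    have := hprod (Classical.arbitrary V)
    rw [← h, zero_pow hk.ne', zero_mul] at this
    exact lt_irrefl _ this
  exact ⟨ρ, x, hρ0, fun i => pos_of_mul_pos_right (hprod i) (pow_pos hρ0 k).le, heig⟩

/-! ### Convergence of the powers of a primitive matrix -/

/-- The powers of a primitive stochastic matrix, applied to a vector, converge to a constant
vector: the maximum of the coordinates decreases, the minimum increases, and a positive power
contracts their difference by a fixed factor. -/
theorem tendsto_pow_mulVec_of_stochastic [Nonempty V] {C : Matrix V V ℝ} (hC : C.IsPrimitive)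
    (hone : C *ᵥ (fun _ => 1) = fun _ => 1) (y : V → ℝ) :
    ∃ l : ℝ, (∀ i, Tendsto (fun t : ℕ => ((C ^ t) *ᵥ y) i) atTop (𝓝 l)) ∧
      ((∀ i, 0 < y i) → 0 < l) := by
  obtain ⟨hC0, k, hk, hpos⟩ := hC
  have hrow : ∀ n i, ∑ j, (C ^ n) i j = 1 := by
    intro n i
    have h := pow_mulVec_eigenvector (A := C) (r := 1) (x := fun _ => 1) (by rw [hone, one_smul]) n
    have := congrFun h i
    simpa [mulVec, dotProduct] using this
  choose hi hhi using fun z : V → ℝ => Finite.exists_max z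
  choose lo hlo using fun z : V → ℝ => Finite.exists_min z
  set Y : ℕ → V → ℝ := fun t => (C ^ t) *ᵥ y with hY
  have hYadd : ∀ t n, Y (t + n) = (C ^ n) *ᵥ Y t := fun t n => by
    simp only [hY]; rw [mulVec_mulVec, ← pow_add, add_comm]
  set a : ℕ → ℝ := fun t => Y t (lo (Y t)) with ha
  set b : ℕ → ℝ := fun t => Y t (hi (Y t)) with hb
  have haY : ∀ t i, a t ≤ Y t i := fun t i => hlo (Y t) i
  have hYb : ∀ t i, Y t i ≤ b t := fun t i => hhi (Y t) i
  have hlow : ∀ n t i, a t ≤ Y (t + n) i := by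
    intro n t i
    rw [hYadd]
    calc a t = ∑ j, (C ^ n) i j * a t := by rw [← Finset.sum_mul, hrow, one_mul]
      _ ≤ _ := Finset.sum_le_sum fun j _ =>
        mul_le_mul_of_nonneg_left (haY t j) (pow_apply_nonneg hC0 _ _ _)
  have hupp : ∀ n t i, Y (t + n) i ≤ b t := by
    intro n t i
    rw [hYadd]
    calc _ ≤ ∑ j, (C ^ n) i j * b t := Finset.sum_le_sum fun j _ =>
        mul_le_mul_of_nonneg_left (hYb t j) (pow_apply_nonneg hC0 _ _ _)
      _ = b t := by rw [← Finset.sum_mul, hrow, one_mul]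
  have hmono : Monotone a := monotone_nat_of_le_succ fun t => hlow 1 t _
  have hanti : Antitone b := antitone_nat_of_succ_le fun t => hupp 1 t _
  have hab : ∀ t, a t ≤ b t := fun t => (haY t (Classical.arbitrary V)).trans (hYb t _)
  obtain ⟨α, hα⟩ : ∃ α, Tendsto a atTop (𝓝 α) :=
    ⟨_, tendsto_atTop_ciSup hmono ⟨b 0, by
      rintro _ ⟨t, rfl⟩; exact (hab t).trans (hanti (Nat.zero_le t))⟩⟩
  obtain ⟨β, hβ⟩ : ∃ β, Tendsto b atTop (𝓝 β) :=
    ⟨_, tendsto_atTop_ciInf hanti ⟨a 0, by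
      rintro _ ⟨t, rfl⟩; exact (hmono (Nat.zero_le t)).trans (hab t)⟩⟩
  -- the contraction factor is governed by the least entry `δ` of `C ^ k`
  obtain ⟨p, hp⟩ := Finite.exists_min fun p : V × V => (C ^ k) p.1 p.2
  set δ : ℝ := (C ^ k) p.1 p.2 with hδ
  have hδ0 : 0 < δ := hpos _ _
  have hcontr : ∀ t, b (t + k) ≤ b t - δ * (b t - a t) := by
    intro t
    have key : ∀ i, δ * (b t - a t) ≤ b t - Y (t + k) i := by
      intro i
      calc δ * (b t - a t) ≤ (C ^ k) i (lo (Y t)) * (b t - Y t (lo (Y t))) :=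
            mul_le_mul_of_nonneg_right (hp (i, lo (Y t))) (sub_nonneg.2 (hab t))
        _ ≤ ∑ j, (C ^ k) i j * (b t - Y t j) :=
            Finset.single_le_sum (f := fun j => (C ^ k) i j * (b t - Y t j))
              (fun j _ => mul_nonneg (hpos i j).le (sub_nonneg.2 (hYb t j))) (Finset.mem_univ _)
        _ = b t - Y (t + k) i := by
            rw [hYadd]
            simp only [mul_sub, Finset.sum_sub_distrib, ← Finset.sum_mul, hrow, one_mul]
            rfl
    linarith [key (hi (Y (t + k)))]
  have hαβ : α = β := by
    have h1 : β ≤ β - δ * (β - α) :=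
      le_of_tendsto_of_tendsto' (hβ.comp (tendsto_add_atTop_nat k))
        (hβ.sub ((hβ.sub hα).const_mul δ)) hcontr
    have h2 : α ≤ β := le_of_tendsto_of_tendsto' hα hβ hab
    nlinarith
  refine ⟨α, fun i => tendsto_of_tendsto_of_tendsto_of_le_of_le hα (hαβ ▸ hβ)
    (fun t => haY t i) (fun t => hYb t i), fun hy => ?_⟩
  have : a 0 ≤ α := hmono.ge_of_tendsto hα 0
  have h0 : 0 < a 0 := by
    have : Y 0 = y := by simp [hY]
    simp only [ha, this]; exact hy _
  linarith

/-- If a primitive matrix `A` has the positive eigenvector `x` with eigenvalue `r`, the vectors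
`r⁻ᵗ Aᵗ y` converge to a multiple of `x`, since `r⁻¹ diag(x)⁻¹ A diag(x)` is stochastic. -/
theorem IsPrimitive.tendsto_pow_mulVec [Nonempty V] (hA : A.IsPrimitive) {r : ℝ} (hr : 0 < r)
    {x : V → ℝ} (hx : ∀ i, 0 < x i) (hAx : A *ᵥ x = r • x) (y : V → ℝ) :
    ∃ l : ℝ, (∀ i, Tendsto (fun t : ℕ => (r ^ t)⁻¹ * ((A ^ t) *ᵥ y) i) atTop (𝓝 (l * x i))) ∧
      ((∀ i, 0 < y i) → 0 < l) := by
  set C : Matrix V V ℝ := of fun i j => (r * x i)⁻¹ * A i j * x j with hCdef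
  have hpow : ∀ n i j, (C ^ n) i j = (r ^ n * x i)⁻¹ * (A ^ n) i j * x j := by
    intro n
    induction n with
    | zero =>
      intro i j
      by_cases h : i = j
      · subst h; simp [(hx i).ne']
      · simp [h]
    | succ n ih =>
      intro i j
      rw [pow_succ, mul_apply, pow_succ A, mul_apply, Finset.mul_sum, Finset.sum_mul]
      refine Finset.sum_congr rfl fun k _ => ?_
      rw [ih, hCdef, of_apply]
      have := (hx i).ne'
      have := (hx k).ne'
      field_simp
      ring
  have hC : C.IsPrimitive := by
    obtain ⟨hA0, k, hk, hpos⟩ := hA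
    refine ⟨fun i j => ?_, k, hk, fun i j => ?_⟩
    · exact mul_nonneg (mul_nonneg (inv_nonneg.2 (mul_pos hr (hx i)).le) (hA0 i j)) (hx j).le
    · rw [hpow]
      exact mul_pos (mul_pos (inv_pos.2 (mul_pos (pow_pos hr k) (hx i))) (hpos i j)) (hx j)
  have hone : C *ᵥ (fun _ => 1) = fun _ => 1 := by
    funext i
    have h := congrFun hAx i
    simp only [mulVec, dotProduct, Pi.smul_apply, smul_eq_mul] at h
    simp only [mulVec, dotProduct, hCdef, of_apply, mul_one, mul_assoc]
    rw [← Finset.mul_sum, h, inv_mul_cancel₀ (mul_pos hr (hx i)).ne']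
  obtain ⟨l, hl, hlpos⟩ := tendsto_pow_mulVec_of_stochastic hC hone (fun i => y i / x i)
  refine ⟨l, fun i => ?_, fun hy => hlpos fun i => div_pos (hy i) (hx i)⟩
  refine ((hl i).mul_const (x i)).congr fun t => ?_
  simp only [mulVec, dotProduct, hpow]
  rw [Finset.sum_mul, Finset.mul_sum]
  refine Finset.sum_congr rfl fun j _ => ?_
  have := (hx i).ne'
  have := (hx j).ne'
  field_simp

/-- A positive eigenvector of a primitive matrix is unique up to scaling. -/
theorem IsPrimitive.eigenvector_unique [Nonempty V] (hA : A.IsPrimitive) {r : ℝ} (hr : 0 < r)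
    {x : V → ℝ} (hx : ∀ i, 0 < x i) (hAx : A *ᵥ x = r • x) {z : ℝ} {y : V → ℝ}
    (hy : ∀ i, 0 < y i) (hAy : A *ᵥ y = z • y) :
    z = r ∧ ∃ a : ℝ, 0 < a ∧ y = a • x := by
  obtain ⟨l, hl, hlpos⟩ := hA.tendsto_pow_mulVec hr hx hAx y
  have hl0 := hlpos hy
  have hlim : ∀ i, Tendsto (fun t : ℕ => (r ^ t)⁻¹ * (z ^ t * y i)) atTop (𝓝 (l * x i)) := by
    intro i
    refine (hl i).congr fun t => ?_
    rw [pow_mulVec_eigenvector hAy]; rfl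
  have hz : z = r := by
    have i := Classical.arbitrary V
    -- shifting the sequence by one multiplies it by `z / r` and leaves its limit unchanged
    have h1 := (hlim i).comp (tendsto_add_atTop_nat 1)
    have h2 := (hlim i).const_mul (z / r)
    have h3 := tendsto_nhds_unique h1 (h2.congr fun t => by
      simp only [Function.comp, pow_succ, mul_inv]; field_simp)
    have h4 : 0 < l * x i := mul_pos hl0 (hx i)
    field_simp at h3
    have h5 : (z - r) * (l * x i) = 0 := by
      have := h4.ne'
      nlinarith
    have := (mul_eq_zero.1 h5).resolve_right h4.ne'
    linarith
  refine ⟨hz, l, hl0, funext fun i => ?_⟩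
  refine tendsto_nhds_unique (tendsto_const_nhds.congr fun t => ?_) (hlim i)
  rw [hz, ← mul_assoc, inv_mul_cancel₀ (pow_pos hr t).ne', one_mul]

/-- The Perron eigenvalue of a primitive matrix strictly dominates the other complex
eigenvalues: an eigenvector of eigenvalue `z` makes the powers `(z / r) ^ t` converge, so that
`z = r` or these powers tend to `0`. -/
theorem IsPrimitive.isMaximalEigenvalue [Nonempty V] (hA : A.IsPrimitive) {r : ℝ} (hr : 0 < r)
    {x : V → ℝ} (hx : ∀ i, 0 < x i) (hAx : A *ᵥ x = r • x) :
    PathGame.IsMaximalEigenvalue A r := by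
  refine ⟨hr, ?_, fun z hz hzr => ?_⟩
  · refine Module.End.hasEigenvalue_of_hasEigenvector (x := fun i => (x i : ℂ)) ?_
    refine ⟨Module.End.mem_eigenspace_iff.2 ?_, fun h => ?_⟩
    · funext i
      have h := congrFun hAx i
      simp only [mulVec, dotProduct, Pi.smul_apply, smul_eq_mul] at h
      simp only [toLin'_apply, mulVec, dotProduct, map_apply, Pi.smul_apply, smul_eq_mul]
      exact_mod_cast h
    · have i := Classical.arbitrary V
      have := congrFun h i
      simp [(hx i).ne'] at this
  · obtain ⟨y, hy, hy0⟩ := hz.exists_hasEigenvector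
    rw [Module.End.mem_eigenspace_iff, toLin'_apply] at hy
    obtain ⟨i, hi⟩ := Function.ne_iff.1 hy0
    have hpow : ∀ t : ℕ, ((A ^ t).map (fun a : ℝ => (a : ℂ))) *ᵥ y = z ^ t • y := by
      intro t
      induction t with
      | zero =>
        have : ((1 : Matrix V V ℝ).map (fun a : ℝ => (a : ℂ))) = 1 :=
          Matrix.map_one _ Complex.ofReal_zero Complex.ofReal_one
        simp [this]
      | succ t ih =>
        have : ((A ^ t * A).map (fun a : ℝ => (a : ℂ))) =
            (A ^ t).map (fun a : ℝ => (a : ℂ)) * A.map (fun a : ℝ => (a : ℂ)) :=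
          Matrix.map_mul (f := Complex.ofRealHom)
        rw [pow_succ, this, ← mulVec_mulVec, hy, mulVec_smul, ih, smul_smul, pow_succ']
    obtain ⟨l₁, h₁, -⟩ := hA.tendsto_pow_mulVec hr hx hAx (fun j => (y j).re)
    obtain ⟨l₂, h₂, -⟩ := hA.tendsto_pow_mulVec hr hx hAx (fun j => (y j).im)
    obtain ⟨L, hL⟩ : ∃ L : ℂ, Tendsto (fun t : ℕ => (z / r) ^ t * y i) atTop (𝓝 L) := by
      refine ⟨((l₁ * x i : ℝ) : ℂ) + ((l₂ * x i : ℝ) : ℂ) * Complex.I, ?_⟩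
      have h1 := (Complex.continuous_ofReal.tendsto _).comp (h₁ i)
      have h2 := (Complex.continuous_ofReal.tendsto _).comp (h₂ i)
      refine (h1.add (h2.mul_const Complex.I)).congr fun t => ?_
      have h3 := congrFun (hpow t) i
      simp only [mulVec, dotProduct, Pi.smul_apply, smul_eq_mul, map_apply] at h3
      rw [div_pow, div_mul_eq_mul_div, ← h3]
      simp only [Function.comp, mulVec, dotProduct]
      push_cast
      rw [div_eq_inv_mul, mul_assoc, ← mul_add, Finset.sum_mul, ← Finset.sum_add_distrib]
      congr 1
      refine Finset.sum_congr rfl fun j _ => ?_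
      rw [mul_assoc, ← mul_add, Complex.re_add_im]
    have hshift : L = z / r * L := by
      refine tendsto_nhds_unique (hL.comp (tendsto_add_atTop_nat 1))
        ((hL.const_mul (z / r)).congr fun t => ?_)
      simp only [Function.comp, pow_succ]; ring
    have hne : z / r ≠ 1 := fun h => hzr (by
      rwa [div_eq_one_iff_eq (Complex.ofReal_ne_zero.2 hr.ne')] at h)
    have hL0 : L = 0 := by
      have : (z / r - 1) * L = 0 := by linear_combination -hshift
      exact (mul_eq_zero.1 this).resolve_left (sub_ne_zero.2 hne)
    have hq : Tendsto (fun t : ℕ => (z / r) ^ t) atTop (𝓝 0) := by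
      have := hL.mul_const (y i)⁻¹
      rw [hL0, zero_mul] at this
      exact this.congr fun t => mul_inv_cancel_right₀ hi _
    have hlt : ‖z / r‖ < 1 := tendsto_pow_atTop_nhds_zero_iff_norm_lt_one.1 hq
    rw [norm_div, Complex.norm_real, Real.norm_of_nonneg hr.le, div_lt_one hr] at hlt
    exact hlt

end Matrix

namespace PathGame

variable {V : Type*} [Fintype V] {G : Digraph V} [DecidableRel G.Adj]

/-! ### The propagation matrix of the digraph -/

variable (G) in
/-- The factor `N_i` by which a correct guess at `i` multiplies the Guesser's fortune if she wagered
all of it: the out-degree, but `2` where the out-degree is `1`. -/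
def payoffFactor (i : V) : ℝ := if outDeg G i = 1 then 2 else (outDeg G i : ℝ)

lemma outDeg_pos {i j : V} (h : G.Adj i j) : 0 < outDeg G i :=
  Finset.card_pos.2 ⟨j, by simp [h]⟩

lemma filter_adj_eq_singleton {i j : V} (hi : outDeg G i = 1) (h : G.Adj i j) :
    Finset.univ.filter (fun k => G.Adj i k) = {j} := by
  obtain ⟨a, ha⟩ := Finset.card_eq_one.1 hi
  have hj : j ∈ Finset.univ.filter (fun k => G.Adj i k) := by simp [h]
  rw [ha, Finset.mem_singleton] at hj
  rw [ha, hj]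

lemma payoffFactor_pos {i j : V} (h : G.Adj i j) : 0 < payoffFactor G i := by
  unfold payoffFactor
  split_ifs
  · norm_num
  · exact_mod_cast outDeg_pos h

lemma outDeg_le_payoffFactor (i : V) : (outDeg G i : ℝ) ≤ payoffFactor G i := by
  unfold payoffFactor
  split_ifs with h
  · rw [h]; norm_num
  · exact le_rfl

lemma propMatrix_of_adj {i j : V} (h : G.Adj i j) : propMatrix G i j = (payoffFactor G i)⁻¹ := by
  simp only [propMatrix, Matrix.of_apply, if_pos h, payoffFactor]
  split_ifs <;> simp

lemma propMatrix_of_not_adj {i j : V} (h : ¬ G.Adj i j) : propMatrix G i j = 0 := by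
  simp [propMatrix, h]

lemma propMatrix_pos {i j : V} (h : G.Adj i j) : 0 < propMatrix G i j := by
  rw [propMatrix_of_adj h]; exact inv_pos.2 (payoffFactor_pos h)

lemma propMatrix_nonneg (i j : V) : 0 ≤ propMatrix G i j := by
  by_cases h : G.Adj i j
  · exact (propMatrix_pos h).le
  · rw [propMatrix_of_not_adj h]

lemma propMatrix_mulVec (x : V → ℝ) (i : V) :
    (propMatrix G).mulVec x i =
      (payoffFactor G i)⁻¹ * ∑ k ∈ Finset.univ.filter (fun k => G.Adj i k), x k := by
  rw [Matrix.mulVec, dotProduct, Finset.mul_sum, Finset.sum_filter]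
  refine Finset.sum_congr rfl fun k _ => ?_
  split_ifs with h
  · rw [propMatrix_of_adj h]
  · rw [propMatrix_of_not_adj h, zero_mul]

lemma nonempty_of_aperiodic {V : Type*} {G : Digraph V} (haper : Aperiodic G) : Nonempty V := by
  by_contra h
  rw [not_nonempty_iff] at h
  have := haper 2 fun n hn => (h.false (hn.2.choose 0)).elim
  omega

/-- In an aperiodic strongly connected digraph every node has an out-neighbour. -/
lemma exists_adj {V : Type*} {G : Digraph V} (hconn : StronglyConnected G) (haper : Aperiodic G)
    (i : V) : ∃ j, G.Adj i j := by
  by_contra! h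
  have hall : ∀ j, j = i := fun j => by
    rcases Relation.ReflTransGen.cases_head (hconn i j) with h' | ⟨k, hk, -⟩
    · exact h'.symm
    · exact absurd hk (h k)
  have := haper 2 fun n hn => by
    obtain ⟨hn, x, -, hx⟩ := hn
    exact absurd (hx 0 hn) (by rw [hall (x 0)]; exact h _)
  omega

lemma IsMove.sum_filter {i : V} {p : V → ℝ} (hp : IsMove G i p) :
    ∑ k ∈ Finset.univ.filter (fun k => G.Adj i k), p k = 1 := by
  rw [← hp.2.2, Finset.sum_filter]
  refine Finset.sum_congr rfl fun k _ => ?_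
  split_ifs with h
  · rfl
  · exact (hp.2.1 k h).symm

lemma IsMove.sum_multiplier {i : V} {g : V → ℝ} (hg : IsMove G i g) (w : ℝ) :
    ∑ k ∈ Finset.univ.filter (fun k => G.Adj i k), (1 - w + payoffFactor G i * w * g k) =
      (outDeg G i : ℝ) * (1 - w) + payoffFactor G i * w := by
  rw [Finset.sum_add_distrib, ← Finset.mul_sum, hg.sum_filter, mul_one, Finset.sum_const,
    nsmul_eq_mul]
  rfl

lemma IsMove.eq_one_of_outDeg_eq_one {i j : V} {p : V → ℝ} (hp : IsMove G i p)
    (hi : outDeg G i = 1) (h : G.Adj i j) : p j = 1 := by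
  rw [← hp.sum_filter, filter_adj_eq_singleton hi h, Finset.sum_singleton]

lemma move_mul_nonneg {V : Type*} [Fintype V] {G : Digraph V}
    (τ : ChooserStrategy G) (σ : GuesserStrategy G) (h : History V) (i j k : V) :
    0 ≤ σ.prob h i j * τ.prob h i (σ.wager h i) k :=
  mul_nonneg ((σ.isMove h i).1 j) ((τ.isMove h i _).1 k)

variable [DecidableEq V]

theorem propMatrix_isPrimitive (hconn : StronglyConnected G) (haper : Aperiodic G) :
    (propMatrix G).IsPrimitive := by
  refine Matrix.isPrimitive_of_period_one propMatrix_nonneg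
    (fun i j => Matrix.exists_pow_apply_pos_of_reflTransGen propMatrix_nonneg
      (fun _ _ => propMatrix_pos) (hconn i j)) fun d hd => haper d ?_
  rintro n ⟨-, x, hx, hadj⟩
  refine hd n (x 0) ?_
  have := Matrix.pow_apply_pos_of_walk propMatrix_nonneg x n fun k hk => propMatrix_pos (hadj k hk)
  rwa [← hx] at this

/-! ### The one-round game on a fan -/

lemma newFortune_eq (i j k : V) (F w : ℝ) : newFortune G i F (w * F) j k =
    F * (1 - w + if j = k then payoffFactor G i * w else 0) := by
  unfold newFortune payoffFactor
  split_ifs <;> ring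

lemma newFortune_nonneg {i j k : V} {F w : ℝ} (hF : 0 ≤ F) (hw : w ∈ Icc (0 : ℝ) 1) :
    0 ≤ newFortune G i F (w * F) j k := by
  rw [newFortune_eq]
  have h0 : 0 ≤ payoffFactor G i := (Nat.cast_nonneg _).trans (outDeg_le_payoffFactor i)
  have h1 := mul_nonneg h0 hw.1
  refine mul_nonneg hF (add_nonneg (sub_nonneg.2 hw.2) ?_)
  split_ifs
  · exact h1
  · exact le_rfl

/-- Averaging over the guess: if the Chooser moves to `k`, the Guesser's fortune is multiplied by
`1 - w + N_i w g_k` in expectation. -/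
lemma sum_sum_newFortune {i : V} {g : V → ℝ} (hg : ∑ j, g j = 1) (c b : V → ℝ) (F w : ℝ) :
    ∑ j, ∑ k, g j * c k * (newFortune G i F (w * F) j k * b k) =
      F * ∑ k, c k * b k * (1 - w + payoffFactor G i * w * g k) := by
  rw [Finset.sum_comm, Finset.mul_sum]
  refine Finset.sum_congr rfl fun k _ => ?_
  have : ∀ j, g j * c k * (newFortune G i F (w * F) j k * b k) =
      F * (c k * b k) * ((1 - w) * g j + if j = k then payoffFactor G i * w * g j else 0) := by
    intro j
    rw [newFortune_eq]
    split_ifs <;> ring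
  simp only [this, ← Finset.mul_sum, Finset.sum_add_distrib, hg, Finset.sum_ite_eq',
    Finset.mem_univ, if_true]
  ring

lemma fanPayoff_eq {i : V} {g : V → ℝ} (hg : ∑ j, g j = 1) (a c : V → ℝ) (w : ℝ) :
    fanPayoff G i a c (g, w) = ∑ k, c k * a k * (1 - w + payoffFactor G i * w * g k) := by
  have := sum_sum_newFortune (G := G) (i := i) hg c a 1 w
  simpa only [fanPayoff, mul_one, one_mul] using this

lemma isMove_single {V : Type*} [Fintype V] [DecidableEq V] {G : Digraph V} {i j : V}
    (h : G.Adj i j) : IsMove G i (Pi.single j 1) := by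
  refine ⟨fun k => ?_, fun k hk => ?_, by simp⟩
  · by_cases hk : k = j
    · subst hk; simp
    · simp [hk]
  · exact Pi.single_eq_of_ne (fun hkj => hk (by rwa [hkj])) _

/-- If the Guesser's plan makes her expected fortune proportional to `1 / a_k`, her payoff in the
fan game is the same for every move of the Chooser. -/
lemma fanPayoff_of_guesser_equalizes {i : V} {a g c : V → ℝ} {w v : ℝ} (hg : ∑ j, g j = 1)
    (hc : IsMove G i c)
    (h : ∀ k, G.Adj i k → a k * (1 - w + payoffFactor G i * w * g k) = v) :
    fanPayoff G i a c (g, w) = v := by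
  rw [fanPayoff_eq hg, show v = ∑ k, c k * v by rw [← Finset.sum_mul, hc.2.2, one_mul]]
  refine Finset.sum_congr rfl fun k _ => ?_
  by_cases hk : G.Adj i k
  · rw [mul_assoc, h k hk]
  · rw [hc.2.1 k hk]; ring

/-- If the Chooser moves to `k` with probability proportional to `1 / a_k`, the Guesser cannot gain
more than the value of the fan game. -/
lemma fanPayoff_le_of_chooser_equalizes {i : V} {a g c : V → ℝ} {w v : ℝ} (hg : IsMove G i g)
    (hw : w ∈ Icc (0 : ℝ) 1) (hv : 0 ≤ v) (hc : ∀ k, ¬ G.Adj i k → c k = 0)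
    (h : ∀ k, G.Adj i k → c k * a k * payoffFactor G i = v) :
    fanPayoff G i a c (g, w) ≤ v := by
  rw [fanPayoff_eq hg.2.2]
  by_cases hex : ∃ j, G.Adj i j
  swap
  · push Not at hex
    refine le_trans (le_of_eq (Finset.sum_eq_zero fun k _ => ?_)) hv
    rw [hc k (hex k)]; ring
  obtain ⟨j, hj⟩ := hex
  have hN := payoffFactor_pos hj
  have hsum : ∑ k, c k * a k * (1 - w + payoffFactor G i * w * g k) =
      v / payoffFactor G i * ((outDeg G i : ℝ) * (1 - w) + payoffFactor G i * w) := by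
    rw [← hg.sum_multiplier, Finset.mul_sum, Finset.sum_filter]
    refine Finset.sum_congr rfl fun k _ => ?_
    split_ifs with hk
    · rw [← h k hk]; field_simp
    · rw [hc k hk]; ring
  rw [hsum, div_mul_eq_mul_div, div_le_iff₀ hN]
  refine mul_le_mul_of_nonneg_left ?_ hv
  nlinarith [mul_nonneg (sub_nonneg.2 hw.2) (sub_nonneg.2 (outDeg_le_payoffFactor (G := G) i))]

/-- The solution of the fan game with positive leaf values `a`: its value is `N_i / ∑ 1 / a_k`, the
Chooser moves to `k` with probability proportional to `1 / a_k`, and the Guesser's play multiplies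
her fortune by `N_i` times that probability if the Chooser moves to `k`. -/
theorem fan_saddlePoint_unique {i : V} (hi : ∃ j, G.Adj i j) {a c g : V → ℝ} {w : ℝ}
    (ha : ∀ k, 0 < a k) (hc : IsMove G i c) (hg : IsMove G i g) (hw : w ∈ Icc (0 : ℝ) 1)
    (hs : IsSaddlePointOn (fanChooser G i) (fanGuesser G i) (fanPayoff G i a) c (g, w))
    {S : ℝ} (hS : S = ∑ k ∈ Finset.univ.filter (fun k => G.Adj i k), (a k)⁻¹) :
    fanPayoff G i a c (g, w) = payoffFactor G i / S ∧
    (∀ k, G.Adj i k → c k = (a k)⁻¹ / S) ∧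
    (outDeg G i = 1 → w = 1) ∧
    (∀ k, G.Adj i k → 1 - w + payoffFactor G i * w * g k = payoffFactor G i * c k) := by
  obtain ⟨j₀, hj₀⟩ := hi
  have hN := payoffFactor_pos hj₀
  have hS0 : 0 < S := by
    rw [hS]
    exact Finset.sum_pos (fun k _ => inv_pos.2 (ha k)) ⟨j₀, by simp [hj₀]⟩
  set N := payoffFactor G i with hNdef
  -- the equalizing strategy of both players
  set p : V → ℝ := fun k => if G.Adj i k then (a k)⁻¹ / S else 0 with hp
  have hpadj : ∀ k, G.Adj i k → p k = (a k)⁻¹ / S := fun k hk => by simp [hp, hk]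
  have hpmove : IsMove G i p := by
    refine ⟨fun k => ?_, fun k hk => by simp [hp, hk], ?_⟩
    · by_cases hk : G.Adj i k
      · rw [hpadj k hk]; exact (div_pos (inv_pos.2 (ha k)) hS0).le
      · simp [hp, hk]
    · rw [hp, ← Finset.sum_filter, ← Finset.sum_div, ← hS, div_self hS0.ne']
  have hone : (1 : ℝ) ∈ Icc (0 : ℝ) 1 := ⟨zero_le_one, le_rfl⟩
  have hpa : ∀ k, G.Adj i k → p k * a k * N = N / S := fun k hk => by
    rw [hpadj k hk]; have := (ha k).ne'; field_simp
  have hup : fanPayoff G i a p (g, w) ≤ N / S :=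
    fanPayoff_le_of_chooser_equalizes hg hw (div_pos hN hS0).le hpmove.2.1 hpa
  have hlow : fanPayoff G i a c (p, 1) = N / S :=
    fanPayoff_of_guesser_equalizes hpmove.2.2 hc fun k hk => by rw [← hpa k hk]; ring
  have hval : fanPayoff G i a c (g, w) = N / S :=
    le_antisymm ((hs p hpmove (g, w) ⟨hg, hw⟩).trans hup)
      (hlow ▸ hs c hc (p, 1) ⟨hpmove, hone⟩)
  -- guessing `k` and wagering everything earns `N c_k a_k`
  have hcle : ∀ k ∈ Finset.univ.filter (fun k => G.Adj i k), c k ≤ p k := by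
    intro k hk
    have hk : G.Adj i k := by simpa using hk
    have h := hs p hpmove (Pi.single k 1, 1) ⟨isMove_single hk, hone⟩
    have h' := h.trans hup
    rw [fanPayoff_eq (by simp)] at h'
    simp only [sub_self, zero_add, mul_one] at h'
    rw [Finset.sum_eq_single k (fun l _ hl => by simp [hl]) (by simp)] at h'
    rw [← hpa k hk] at h'
    simp only [Pi.single_eq_same, mul_one, ← hNdef] at h'
    have := le_of_mul_le_mul_right h' hN
    exact le_of_mul_le_mul_right this (ha k)
  have hcp : ∀ k, G.Adj i k → c k = p k := by
    have := (Finset.sum_eq_sum_iff_of_le hcle).1 (by rw [hc.sum_filter, hpmove.sum_filter])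
    exact fun k hk => this k (by simp [hk])
  -- moving to `k` for certain limits the Guesser to `a_k (1 - w + N w g_k)`
  have hgle : ∀ k ∈ Finset.univ.filter (fun k => G.Adj i k), N * p k ≤ 1 - w + N * w * g k := by
    intro k hk
    have hk : G.Adj i k := by simpa using hk
    have h := hs (Pi.single k 1) (isMove_single hk) (p, 1) ⟨hpmove, hone⟩
    rw [hlow, fanPayoff_eq hg.2.2,
      Finset.sum_eq_single k (fun l _ hl => by simp [hl]) (by simp)] at h
    simp only [Pi.single_eq_same, one_mul, ← hNdef] at h
    rw [← hpa k hk, mul_right_comm, mul_comm (p k * N), mul_comm (p k)] at h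
    exact le_of_mul_le_mul_left h (ha k)
  have hsum1 : ∑ k ∈ Finset.univ.filter (fun k => G.Adj i k), N * p k = N := by
    rw [← Finset.mul_sum, hpmove.sum_filter, mul_one]
  have hsum2 := hg.sum_multiplier w
  rw [← hNdef] at hsum2
  have hsumle := Finset.sum_le_sum hgle
  rw [hsum1, hsum2] at hsumle
  have hle := mul_nonneg (sub_nonneg.2 hw.2) (sub_nonneg.2 (outDeg_le_payoffFactor (G := G) i))
  rw [← hNdef] at hle
  have hsumeq : N = (outDeg G i : ℝ) * (1 - w) + N * w := by nlinarith
  have hgeq := (Finset.sum_eq_sum_iff_of_le hgle).1 (by rw [hsum1, hsum2]; exact hsumeq)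
  refine ⟨hval, fun k hk => (hcp k hk).trans (hpadj k hk), fun h1 => ?_, fun k hk => ?_⟩
  · have hN2 : N = 2 := by simp [hNdef, payoffFactor, h1]
    rw [hN2, h1] at hsumeq
    push_cast at hsumeq
    linarith
  · rw [hcp k hk, hgeq k (by simp [hk])]

/-! ### The expected payoff after several rounds -/

lemma expPayoffFrom_succ (τ : ChooserStrategy G) (σ : GuesserStrategy G) (f : V → ℝ) (t : ℕ)
    (h : History V) (i : V) (F : ℝ) : expPayoffFrom τ σ f (t + 1) h i F =
      ∑ j, ∑ k, σ.prob h i j * τ.prob h i (σ.wager h i) k *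
        expPayoffFrom τ σ f t ((i, j, σ.wager h i) :: h) k
          (newFortune G i F (σ.wager h i * F) j k) := rfl

lemma expPayoffFrom_mono (τ : ChooserStrategy G) (σ : GuesserStrategy G) {f f' : V → ℝ}
    (hf : ∀ i, f i ≤ f' i) (t : ℕ) (h : History V) (i : V) {F : ℝ} (hF : 0 ≤ F) :
    expPayoffFrom τ σ f t h i F ≤ expPayoffFrom τ σ f' t h i F := by
  induction t generalizing h i F with
  | zero => exact mul_le_mul_of_nonneg_left (hf i) hF
  | succ t ih =>
    exact Finset.sum_le_sum fun j _ => Finset.sum_le_sum fun k _ => mul_le_mul_of_nonneg_left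
      (ih _ _ (newFortune_nonneg hF (σ.wager_mem h i))) (move_mul_nonneg τ σ h i j k)

lemma expPayoffFrom_const_mul (τ : ChooserStrategy G) (σ : GuesserStrategy G) (a : ℝ) (f : V → ℝ)
    (t : ℕ) (h : History V) (i : V) (F : ℝ) :
    expPayoffFrom τ σ (fun j => a * f j) t h i F = a * expPayoffFrom τ σ f t h i F := by
  induction t generalizing h i F with
  | zero => exact mul_left_comm _ _ _
  | succ t ih =>
    simp only [expPayoffFrom_succ, ih, Finset.mul_sum]
    exact Finset.sum_congr rfl fun j _ => Finset.sum_congr rfl fun k _ => mul_left_comm _ _ _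

/-- If no round increases the expectation of the discounted fortune times the node value, neither
does a play of `t` rounds. -/
theorem expPayoffFrom_le {τ : ChooserStrategy G} {σ : GuesserStrategy G} {d : ℝ} (hd : 0 ≤ d)
    {v : V → ℝ} (hfan : ∀ h i, fanPayoff G i (fun k => d * v k) (τ.prob h i (σ.wager h i))
      (σ.prob h i, σ.wager h i) ≤ v i) (t : ℕ) (h : History V) (i : V) {F : ℝ} (hF : 0 ≤ F) :
    d ^ t * expPayoffFrom τ σ v t h i F ≤ F * v i := by
  induction t generalizing h i F with
  | zero => simp [expPayoffFrom]
  | succ t ih =>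
    refine le_trans ?_ (mul_le_mul_of_nonneg_left (hfan h i) hF)
    rw [fanPayoff_eq (σ.isMove h i).2.2, ← sum_sum_newFortune (σ.isMove h i).2.2,
      expPayoffFrom_succ]
    simp only [Finset.mul_sum]
    refine Finset.sum_le_sum fun j _ => Finset.sum_le_sum fun k _ => ?_
    rw [mul_left_comm]
    refine mul_le_mul_of_nonneg_left ?_ (move_mul_nonneg τ σ h i j k)
    rw [pow_succ', mul_assoc, mul_left_comm _ d]
    exact mul_le_mul_of_nonneg_left (ih _ _ (newFortune_nonneg hF (σ.wager_mem h i))) hd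

/-- If no round decreases the expectation of the discounted fortune times the node value, neither
does a play of `t` rounds. -/
theorem le_expPayoffFrom {τ : ChooserStrategy G} {σ : GuesserStrategy G} {d : ℝ} (hd : 0 ≤ d)
    {v : V → ℝ} (hfan : ∀ h i, v i ≤ fanPayoff G i (fun k => d * v k) (τ.prob h i (σ.wager h i))
      (σ.prob h i, σ.wager h i)) (t : ℕ) (h : History V) (i : V) {F : ℝ} (hF : 0 ≤ F) :
    F * v i ≤ d ^ t * expPayoffFrom τ σ v t h i F := by
  induction t generalizing h i F with
  | zero => simp [expPayoffFrom]
  | succ t ih =>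
    refine le_trans (mul_le_mul_of_nonneg_left (hfan h i) hF) ?_
    rw [fanPayoff_eq (σ.isMove h i).2.2, ← sum_sum_newFortune (σ.isMove h i).2.2,
      expPayoffFrom_succ]
    simp only [Finset.mul_sum]
    refine Finset.sum_le_sum fun j _ => Finset.sum_le_sum fun k _ => ?_
    rw [mul_left_comm (d ^ (t + 1))]
    refine mul_le_mul_of_nonneg_left ?_ (move_mul_nonneg τ σ h i j k)
    rw [pow_succ', mul_assoc, mul_left_comm _ d]
    exact mul_le_mul_of_nonneg_left (ih _ _ (newFortune_nonneg hF (σ.wager_mem h i))) hd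

/-- Under positional strategies the expected payoff is proportional to the initial fortune and does
not depend on the past. -/
lemma expPayoffFrom_positional (c : PositionalChooser G) (g : PositionalGuesser G) (f : V → ℝ)
    (t : ℕ) (h : History V) (i : V) (F : ℝ) :
    expPayoffFrom c.toStrategy g.toStrategy f t h i F =
      F * expPayoff c.toStrategy g.toStrategy f t i := by
  induction t generalizing h i F with
  | zero => simp [expPayoffFrom, expPayoff]
  | succ t ih =>
    rw [expPayoff, expPayoffFrom_succ, expPayoffFrom_succ]
    simp only [ih]
    rw [sum_sum_newFortune (g.toStrategy.isMove _ _).2.2,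
      sum_sum_newFortune (g.toStrategy.isMove _ _).2.2, one_mul]
    rfl

lemma expPayoff_positional_succ (c : PositionalChooser G) (g : PositionalGuesser G) (f : V → ℝ)
    (t : ℕ) (i : V) : expPayoff c.toStrategy g.toStrategy f (t + 1) i =
      fanPayoff G i (expPayoff c.toStrategy g.toStrategy f t) (c.prob i) (g.prob i, g.wager i) := by
  rw [expPayoff, expPayoffFrom_succ, fanPayoff_eq (g.isMove i).2.2]
  simp only [expPayoffFrom_positional]
  rw [sum_sum_newFortune (g.toStrategy.isMove _ _).2.2, one_mul]
  rfl

end PathGame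

namespace PathGame

variable {V : Type*} [Fintype V] {G : Digraph V} [DecidableRel G.Adj]

/-! ### The limiting strategies -/

lemma two_le_outDeg {i j : V} (h : G.Adj i j) (hi : outDeg G i ≠ 1) : 2 ≤ outDeg G i := by
  have := outDeg_pos h
  omega

lemma payoffFactor_of_two_le {i : V} (hi : 2 ≤ outDeg G i) : payoffFactor G i = outDeg G i := by
  rw [payoffFactor, if_neg (by omega)]

lemma sum_adj_eq {r : ℝ} {u : V → ℝ} (hMu : (propMatrix G).mulVec u = r • u) {i j : V}
    (hij : G.Adj i j) :
    ∑ k ∈ Finset.univ.filter (fun k => G.Adj i k), u k = payoffFactor G i * (r * u i) := by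
  have h := congrFun hMu i
  rw [propMatrix_mulVec, Pi.smul_apply, smul_eq_mul] at h
  rw [← h, mul_inv_cancel_left₀ (payoffFactor_pos hij).ne']

/-- Where the out-degree is `1`, the eigenvector equation makes `u_j / (N_i r u_i)` equal to `1`, so
that one formula covers all nodes. -/
lemma payoffFactor_mul_limitingProb {r : ℝ} (hr : 0 < r) {u : V → ℝ} (hu : ∀ i, 0 < u i)
    (hMu : (propMatrix G).mulVec u = r • u) {i j : V} (hij : G.Adj i j) :
    payoffFactor G i * limitingProb G u i j = u j / (r * u i) := by
  have hs := sum_adj_eq hMu hij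
  have hN := (payoffFactor_pos hij).ne'
  have hui := (hu i).ne'
  rw [limitingProb, if_pos hij]
  split_ifs with h1
  · rw [filter_adj_eq_singleton h1 hij, Finset.sum_singleton] at hs
    rw [hs]
    field_simp
  · rw [hs]
    field_simp

lemma limitingProb_eq {r : ℝ} (hr : 0 < r) {u : V → ℝ} (hu : ∀ i, 0 < u i)
    (hMu : (propMatrix G).mulVec u = r • u) (i j : V) :
    limitingProb G u i j = propMatrix G i j * u j / (r * u i) := by
  by_cases hij : G.Adj i j
  · have hN := (payoffFactor_pos hij).ne'
    rw [propMatrix_of_adj hij, mul_div_assoc, ← payoffFactor_mul_limitingProb hr hu hMu hij,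
      inv_mul_cancel_left₀ hN]
  · rw [propMatrix_of_not_adj hij, limitingProb, if_neg hij]; simp

lemma limitingProb_pos {r : ℝ} (hr : 0 < r) {u : V → ℝ} (hu : ∀ i, 0 < u i)
    (hMu : (propMatrix G).mulVec u = r • u) {i j : V} (hij : G.Adj i j) :
    0 < limitingProb G u i j := by
  rw [limitingProb_eq hr hu hMu]
  exact div_pos (mul_pos (propMatrix_pos hij) (hu j)) (mul_pos hr (hu i))

lemma isMove_limitingProb {r : ℝ} (hr : 0 < r) {u : V → ℝ} (hu : ∀ i, 0 < u i)
    (hMu : (propMatrix G).mulVec u = r • u) (i : V) : IsMove G i (limitingProb G u i) := by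
  refine ⟨fun j => ?_, fun j hj => by rw [limitingProb, if_neg hj], ?_⟩
  · rw [limitingProb_eq hr hu hMu]
    exact div_nonneg (mul_nonneg (propMatrix_nonneg i j) (hu j).le) (mul_pos hr (hu i)).le
  · have h := congrFun hMu i
    simp only [Matrix.mulVec, dotProduct, Pi.smul_apply, smul_eq_mul] at h
    simp only [limitingProb_eq hr hu hMu]
    rw [← Finset.sum_div, h, div_self (mul_pos hr (hu i)).ne']

lemma limitingProbMin_le (u : V → ℝ) {i j : V} (hij : G.Adj i j) :
    limitingProbMin G u i ≤ limitingProb G u i j :=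
  csInf_le (Set.toFinite _).bddBelow ⟨j, hij, rfl⟩

lemma exists_limitingProb_eq_min (u : V → ℝ) {i : V} (hi : ∃ j, G.Adj i j) :
    ∃ j, G.Adj i j ∧ limitingProb G u i j = limitingProbMin G u i := by
  obtain ⟨j, hj, h⟩ := ((Set.toFinite (limitingProb G u i '' {j | G.Adj i j})).isCompact).sInf_mem
    (Set.Nonempty.image _ hi)
  exact ⟨j, hj, h⟩

lemma limitingProbMin_pos {r : ℝ} (hr : 0 < r) {u : V → ℝ} (hu : ∀ i, 0 < u i)
    (hMu : (propMatrix G).mulVec u = r • u) {i : V} (hi : ∃ j, G.Adj i j) :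
    0 < limitingProbMin G u i := by
  obtain ⟨j, hj, h⟩ := exists_limitingProb_eq_min u hi
  rw [← h]
  exact limitingProb_pos hr hu hMu hj

lemma outDeg_mul_limitingProbMin_le {r : ℝ} (hr : 0 < r) {u : V → ℝ} (hu : ∀ i, 0 < u i)
    (hMu : (propMatrix G).mulVec u = r • u) (i : V) :
    (outDeg G i : ℝ) * limitingProbMin G u i ≤ 1 := by
  rw [← (isMove_limitingProb hr hu hMu i).sum_filter, outDeg, ← nsmul_eq_mul, ← Finset.sum_const]
  exact Finset.sum_le_sum fun k hk => limitingProbMin_le u (by simpa using hk)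

lemma exists_isLimitingGuesser {r : ℝ} (hr : 0 < r) {u : V → ℝ} (hu : ∀ i, 0 < u i)
    (hMu : (propMatrix G).mulVec u = r • u) (hG : ∀ i, ∃ j, G.Adj i j) {β : V → ℝ}
    (hβ : ∀ i, β i ∈ Icc (0 : ℝ) 1) : ∃ g : PositionalGuesser G, IsLimitingGuesser u β g := by
  have hm := fun i => limitingProbMin_pos hr hu hMu (hG i)
  set w : V → ℝ := fun i => if outDeg G i = 1 then 1 else
    1 - (outDeg G i : ℝ) * β i * limitingProbMin G u i with hw
  have hw' : ∀ i, outDeg G i ≠ 1 → w i = 1 - (outDeg G i : ℝ) * β i * limitingProbMin G u i :=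
    fun i hi => if_neg hi
  have hwm : ∀ i, w i ∈ Icc (0 : ℝ) 1 := by
    intro i
    by_cases h1 : outDeg G i = 1
    · simp [hw, h1]
    · rw [hw' i h1]
      have h2 := outDeg_mul_limitingProbMin_le hr hu hMu i
      have h3 : 0 ≤ (outDeg G i : ℝ) * limitingProbMin G u i :=
        mul_nonneg (Nat.cast_nonneg _) (hm i).le
      constructor <;> nlinarith [mul_nonneg (hβ i).1 h3, mul_le_mul_of_nonneg_right (hβ i).2 h3]
  -- where the wager is `0` the guess is arbitrary
  have key : ∀ i, ∃ p : V → ℝ, IsMove G i p ∧ (2 ≤ outDeg G i → w i ≠ 0 → ∀ j, G.Adj i j →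
      p j = (limitingProb G u i j - β i * limitingProbMin G u i) / w i) := by
    intro i
    by_cases h : 2 ≤ outDeg G i ∧ w i ≠ 0
    swap
    · exact ⟨_, isMove_limitingProb hr hu hMu i, fun h1 h2 => absurd ⟨h1, h2⟩ h⟩
    have hwpos : 0 < w i := lt_of_le_of_ne (hwm i).1 (Ne.symm h.2)
    refine ⟨fun j => if G.Adj i j then
      (limitingProb G u i j - β i * limitingProbMin G u i) / w i else 0,
      ⟨fun j => ?_, fun j hj => by simp [hj], ?_⟩, fun _ _ j hj => by simp [hj]⟩
    · dsimp only
      split_ifs with hj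
      · have h1 := limitingProbMin_le u hj
        have h2 := mul_le_of_le_one_left (hm i).le (hβ i).2
        exact div_nonneg (by linarith) hwpos.le
      · exact le_rfl
    · rw [← Finset.sum_filter, ← Finset.sum_div, Finset.sum_sub_distrib,
        (isMove_limitingProb hr hu hMu i).sum_filter, Finset.sum_const, nsmul_eq_mul,
        div_eq_one_iff_eq h.2, hw' i (by omega), ← mul_assoc]
      rfl
  choose p hp hpeq using key
  refine ⟨⟨p, w, hp, hwm⟩, fun i => ⟨fun h1 => ⟨by simp [hw, h1], fun j hj =>
    (hp i).eq_one_of_outDeg_eq_one h1 hj⟩, fun h2 => ⟨hw' i (by omega), fun h0 j hj => ?_⟩⟩⟩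
  rw [← hw' i (by omega)]
  exact hpeq i h2 h0 j hj

/-- If the Chooser moves to `j`, a limiting strategy of the Guesser multiplies her fortune by
`N_i c_{ij}` in expectation, whatever the parameters. -/
lemma IsLimitingGuesser.multiplier {r : ℝ} (hr : 0 < r) {u β : V → ℝ} (hu : ∀ i, 0 < u i)
    (hMu : (propMatrix G).mulVec u = r • u) (hβ : ∀ i, β i ∈ Icc (0 : ℝ) 1)
    {g : PositionalGuesser G} (hg : IsLimitingGuesser u β g) {i j : V} (hij : G.Adj i j) :
    1 - g.wager i + payoffFactor G i * g.wager i * g.prob i j =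
      payoffFactor G i * limitingProb G u i j := by
  by_cases h1 : outDeg G i = 1
  · obtain ⟨hw, hp⟩ := (hg i).1 h1
    rw [hw, hp j hij, limitingProb, if_pos hij, if_pos h1]; ring
  have h2 := two_le_outDeg hij h1
  obtain ⟨hw, hp⟩ := (hg i).2 h2
  rw [payoffFactor_of_two_le h2]
  by_cases h0 : g.wager i = 0
  · -- the wager vanishes only if all `c_{ij}` equal `1 / n_i`
    have hm := limitingProbMin_pos hr hu hMu ⟨j, hij⟩
    have hn := outDeg_mul_limitingProbMin_le hr hu hMu i
    have hnm : (outDeg G i : ℝ) * limitingProbMin G u i = 1 := by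
      have h3 : 0 ≤ (outDeg G i : ℝ) * limitingProbMin G u i :=
        mul_nonneg (Nat.cast_nonneg _) hm.le
      nlinarith [mul_le_mul_of_nonneg_right (hβ i).2 h3]
    have heq := (Finset.sum_eq_sum_iff_of_le (f := fun _ => limitingProbMin G u i)
      (g := limitingProb G u i) (s := Finset.univ.filter (fun k => G.Adj i k))
      fun k hk => limitingProbMin_le u (by simpa using hk)).1 (by
        rw [(isMove_limitingProb hr hu hMu i).sum_filter, Finset.sum_const, nsmul_eq_mul]
        exact hnm) j (by simp [hij])
    rw [← heq, hnm, h0]; ring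
  · rw [hp h0 j hij, ← hw, mul_assoc, mul_div_cancel₀ _ h0, hw]
    ring

end PathGame

/-! ### Exponential growth rates -/

namespace ENNReal

lemma tendsto_ofReal_const_mul_pow_rpow {C a : ℝ} (hC : 0 < C) (ha : 0 < a) :
    Tendsto (fun t : ℕ => ENNReal.ofReal (C * a ^ t) ^ (1 / (t : ℝ))) atTop
      (𝓝 (ENNReal.ofReal a)) := by
  have h1 : Tendsto (fun t : ℕ => C ^ (1 / (t : ℝ)) * a) atTop (𝓝 a) := by
    have h : Tendsto (fun t : ℕ => C ^ (1 / (t : ℝ))) atTop (𝓝 (C ^ (0 : ℝ))) :=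
      (Real.continuousAt_const_rpow hC.ne').tendsto.comp tendsto_one_div_atTop_nhds_zero_nat
    simpa using h.mul_const a
  refine (ENNReal.tendsto_ofReal h1).congr' ?_
  filter_upwards [eventually_gt_atTop 0] with t ht
  have ht' : (t : ℝ) ≠ 0 := by exact_mod_cast ht.ne'
  rw [ENNReal.ofReal_rpow_of_pos (by positivity),
    Real.mul_rpow hC.le (pow_pos ha t).le, ← Real.rpow_natCast a t, ← Real.rpow_mul ha.le,
    mul_one_div_cancel ht', Real.rpow_one]

lemma limsup_rpow_le {C a : ℝ} (hC : 0 < C) (ha : 0 < a) {e : ℕ → ℝ}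
    (he : ∀ t, e t ≤ C * a ^ t) :
    limsup (fun t : ℕ => ENNReal.ofReal (e t) ^ (1 / (t : ℝ))) atTop ≤ ENNReal.ofReal a := by
  rw [← (tendsto_ofReal_const_mul_pow_rpow hC ha).limsup_eq]
  exact limsup_le_limsup (Eventually.of_forall fun t =>
    ENNReal.rpow_le_rpow (ENNReal.ofReal_le_ofReal (he t)) (by positivity))

lemma le_liminf_rpow {C a : ℝ} (hC : 0 < C) (ha : 0 < a) {e : ℕ → ℝ}
    (he : ∀ t, C * a ^ t ≤ e t) :
    ENNReal.ofReal a ≤ liminf (fun t : ℕ => ENNReal.ofReal (e t) ^ (1 / (t : ℝ))) atTop := by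
  rw [← (tendsto_ofReal_const_mul_pow_rpow hC ha).liminf_eq]
  exact liminf_le_liminf (Eventually.of_forall fun t =>
    ENNReal.rpow_le_rpow (ENNReal.ofReal_le_ofReal (he t)) (by positivity))

end ENNReal

namespace PathGame

variable {V : Type*} [Fintype V] [DecidableEq V] {G : Digraph V} [DecidableRel G.Adj]

lemma expFortune_le {τ : ChooserStrategy G} {σ : GuesserStrategy G} {d : ℝ} (hd : 0 < d)
    {v : V → ℝ} {m : ℝ} (hm : 0 < m) (hmv : ∀ i, m ≤ v i) {t : ℕ} {i : V}
    (h : d ^ t * expPayoff τ σ v t i ≤ v i) :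
    expFortune τ σ t i ≤ m⁻¹ * v i * d⁻¹ ^ t := by
  have h1 : expFortune τ σ t i ≤ m⁻¹ * expPayoff τ σ v t i := by
    unfold expFortune expPayoff
    rw [← expPayoffFrom_const_mul]
    refine expPayoffFrom_mono τ σ (fun j => ?_) t [] i zero_le_one
    rw [inv_mul_eq_div, one_le_div hm]
    exact hmv j
  refine h1.trans ?_
  rw [mul_assoc, inv_pow, ← div_eq_mul_inv]
  refine mul_le_mul_of_nonneg_left ?_ (inv_pos.2 hm).le
  rw [le_div_iff₀ (pow_pos hd t), mul_comm]
  exact h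

lemma le_expFortune {τ : ChooserStrategy G} {σ : GuesserStrategy G} {d : ℝ} (hd : 0 < d)
    {v : V → ℝ} {m : ℝ} (hm : 0 < m) (hmv : ∀ i, v i ≤ m) {t : ℕ} {i : V}
    (h : v i ≤ d ^ t * expPayoff τ σ v t i) :
    m⁻¹ * v i * d⁻¹ ^ t ≤ expFortune τ σ t i := by
  have h1 : m⁻¹ * expPayoff τ σ v t i ≤ expFortune τ σ t i := by
    unfold expFortune expPayoff
    rw [← expPayoffFrom_const_mul]
    refine expPayoffFrom_mono τ σ (fun j => ?_) t [] i zero_le_one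
    rw [inv_mul_eq_div, div_le_one hm]
    exact hmv j
  refine le_trans ?_ h1
  rw [mul_assoc, inv_pow, ← div_eq_mul_inv]
  refine mul_le_mul_of_nonneg_left ?_ (inv_pos.2 hm).le
  rw [div_le_iff₀ (pow_pos hd t), mul_comm]
  exact h

lemma upperGrowth_le {τ : ChooserStrategy G} {σ : GuesserStrategy G} {d : ℝ} (hd : 0 < d)
    {v : V → ℝ} (hv : ∀ i, 0 < v i) {i : V} (h : ∀ t, d ^ t * expPayoff τ σ v t i ≤ v i) :
    upperGrowth i τ σ ≤ ENNReal.ofReal d⁻¹ := by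
  have : Nonempty V := ⟨i⟩
  obtain ⟨k, hk⟩ := Finite.exists_min v
  exact ENNReal.limsup_rpow_le (mul_pos (inv_pos.2 (hv k)) (hv i)) (inv_pos.2 hd)
    fun t => expFortune_le hd (hv k) hk (h t)

lemma le_lowerGrowth {τ : ChooserStrategy G} {σ : GuesserStrategy G} {d : ℝ} (hd : 0 < d)
    {v : V → ℝ} (hv : ∀ i, 0 < v i) {i : V} (h : ∀ t, v i ≤ d ^ t * expPayoff τ σ v t i) :
    ENNReal.ofReal d⁻¹ ≤ lowerGrowth i τ σ := by
  have : Nonempty V := ⟨i⟩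
  obtain ⟨k, hk⟩ := Finite.exists_max v
  exact ENNReal.le_liminf_rpow (mul_pos (inv_pos.2 (hv k)) (hv i)) (inv_pos.2 hd)
    fun t => le_expFortune hd (hv k) hk (h t)

lemma lowerGrowth_le_upperGrowth (i : V) (τ : ChooserStrategy G) (σ : GuesserStrategy G) :
    lowerGrowth i τ σ ≤ upperGrowth i τ σ := liminf_le_limsup

/-! ### Optimality of the limiting strategies -/

/-- With node values `κ / u`, the Chooser's limiting strategy holds the Guesser down to the node's
value in each round. -/
lemma fanPayoff_limitingChooser_le {r κ : ℝ} (hr : 0 < r) (hκ : 0 < κ) {u : V → ℝ}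
    (hu : ∀ i, 0 < u i) (hMu : (propMatrix G).mulVec u = r • u) {c : PositionalChooser G}
    (hc : IsLimitingChooser u c) (i : V) {g : V → ℝ} {w : ℝ} (hg : IsMove G i g)
    (hw : w ∈ Icc (0 : ℝ) 1) :
    fanPayoff G i (fun k => r * (κ * (u k)⁻¹)) (c.prob i) (g, w) ≤ κ * (u i)⁻¹ := by
  refine fanPayoff_le_of_chooser_equalizes hg hw (mul_pos hκ (inv_pos.2 (hu i))).le
    (c.isMove i).2.1 fun k hk => ?_
  have h := payoffFactor_mul_limitingProb hr hu hMu hk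
  have hui := (hu i).ne'
  have huk := (hu k).ne'
  rw [hc, mul_right_comm, mul_comm (limitingProb G u i k), h]
  field_simp

/-- With node values `κ / u`, the Guesser's limiting strategies secure exactly the node's value in
each round, whatever the Chooser does. -/
lemma fanPayoff_limitingGuesser_eq {r κ : ℝ} (hr : 0 < r) {u β : V → ℝ}
    (hu : ∀ i, 0 < u i) (hMu : (propMatrix G).mulVec u = r • u) (hβ : ∀ i, β i ∈ Icc (0 : ℝ) 1)
    {g : PositionalGuesser G} (hg : IsLimitingGuesser u β g) (i : V) {c : V → ℝ}
    (hc : IsMove G i c) :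
    fanPayoff G i (fun k => r * (κ * (u k)⁻¹)) c (g.prob i, g.wager i) = κ * (u i)⁻¹ := by
  refine fanPayoff_of_guesser_equalizes (g.isMove i).2.2 hc fun k hk => ?_
  have hui := (hu i).ne'
  have huk := (hu k).ne'
  rw [hg.multiplier hr hu hMu hβ hk, payoffFactor_mul_limitingProb hr hu hMu hk]
  field_simp

/-- Under the limiting strategies the expected fortune evolves by the propagation matrix,
conjugated by `diag(u)²` and scaled by `r⁻²`. -/
lemma expFortune_limiting {r : ℝ} (hr : 0 < r) {u β : V → ℝ} (hu : ∀ i, 0 < u i)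
    (hMu : (propMatrix G).mulVec u = r • u) (hβ : ∀ i, β i ∈ Icc (0 : ℝ) 1)
    {c : PositionalChooser G} (hc : IsLimitingChooser u c)
    {g : PositionalGuesser G} (hg : IsLimitingGuesser u β g) (t : ℕ) (i : V) :
    expFortune c.toStrategy g.toStrategy t i =
      ((r ^ t * u i) ^ 2)⁻¹ * (propMatrix G ^ t).mulVec (fun j => u j ^ 2) i := by
  induction t generalizing i with
  | zero =>
    have := (hu i).ne'
    simp only [expFortune, expPayoff, expPayoffFrom, pow_zero, Matrix.one_mulVec]
    field_simp
  | succ t ih =>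
    have ih' : expPayoff c.toStrategy g.toStrategy (fun _ => 1) t = fun i =>
      ((r ^ t * u i) ^ 2)⁻¹ * (propMatrix G ^ t).mulVec (fun j => u j ^ 2) i := funext ih
    rw [expFortune, expPayoff_positional_succ, fanPayoff_eq (g.isMove i).2.2, ih',
      pow_succ' (propMatrix G) t, ← Matrix.mulVec_mulVec, Matrix.mulVec, dotProduct, Finset.mul_sum]
    refine Finset.sum_congr rfl fun k _ => ?_
    by_cases hk : G.Adj i k
    · rw [hg.multiplier hr hu hMu hβ hk, payoffFactor_mul_limitingProb hr hu hMu hk, hc,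
        limitingProb_eq hr hu hMu]
      have hui := (hu i).ne'
      have huk := (hu k).ne'
      field_simp
      ring
    · rw [(c.isMove i).2.1 k hk, propMatrix_of_not_adj hk]; ring

lemma tendsto_expFortune_limiting {r κ : ℝ} (hr : 0 < r) {u β : V → ℝ} (hu : ∀ i, 0 < u i)
    (hMu : (propMatrix G).mulVec u = r • u) (hβ : ∀ i, β i ∈ Icc (0 : ℝ) 1)
    {c : PositionalChooser G} (hc : IsLimitingChooser u c)
    {g : PositionalGuesser G} (hg : IsLimitingGuesser u β g) {i : V}
    (hκ : Tendsto (fun t : ℕ => (r ^ t)⁻¹ * (propMatrix G ^ t).mulVec (fun j => u j ^ 2) i) atTop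
      (𝓝 (κ * u i))) :
    Tendsto (fun t : ℕ => r ^ t * expFortune c.toStrategy g.toStrategy t i) atTop
      (𝓝 (κ * (u i)⁻¹)) := by
  have hui := (hu i).ne'
  have h := hκ.const_mul (u i ^ 2)⁻¹
  rw [show (u i ^ 2)⁻¹ * (κ * u i) = κ * (u i)⁻¹ by field_simp] at h
  refine h.congr fun t => ?_
  rw [expFortune_limiting hr hu hMu hβ hc hg]
  field_simp

/-- No play against the Chooser's limiting strategy increases the expectation of the discounted
fortune times the node value. -/
lemma expPayoff_limitingChooser_le {r κ : ℝ} (hr : 0 < r) (hκ : 0 < κ) {u : V → ℝ}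
    (hu : ∀ i, 0 < u i) (hMu : (propMatrix G).mulVec u = r • u) {c : PositionalChooser G}
    (hc : IsLimitingChooser u c) (σ : GuesserStrategy G) (t : ℕ) (i : V) :
    r ^ t * expPayoff c.toStrategy σ (fun j => κ * (u j)⁻¹) t i ≤ κ * (u i)⁻¹ := by
  have h := expPayoffFrom_le (τ := c.toStrategy) (σ := σ) hr.le (v := fun j => κ * (u j)⁻¹)
    (fun h i => fanPayoff_limitingChooser_le hr hκ hu hMu hc i (σ.isMove h i) (σ.wager_mem h i))
    t [] i zero_le_one
  rwa [one_mul] at h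

/-- Every play against a limiting strategy of the Guesser preserves the expectation of the
discounted fortune times the node value. -/
lemma expPayoff_limitingGuesser_eq {r κ : ℝ} (hr : 0 < r) {u β : V → ℝ}
    (hu : ∀ i, 0 < u i) (hMu : (propMatrix G).mulVec u = r • u) (hβ : ∀ i, β i ∈ Icc (0 : ℝ) 1)
    {g : PositionalGuesser G} (hg : IsLimitingGuesser u β g) (τ : ChooserStrategy G) (t : ℕ)
    (i : V) :
    r ^ t * expPayoff τ g.toStrategy (fun j => κ * (u j)⁻¹) t i = κ * (u i)⁻¹ := by
  have hfan : ∀ h i, fanPayoff G i (fun k => r * (κ * (u k)⁻¹))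
      (τ.prob h i (g.toStrategy.wager h i)) (g.toStrategy.prob h i, g.toStrategy.wager h i) =
      κ * (u i)⁻¹ :=
    fun h i => fanPayoff_limitingGuesser_eq hr hu hMu hβ hg i (τ.isMove h i _)
  have h1 := expPayoffFrom_le (τ := τ) (σ := g.toStrategy) hr.le (v := fun j => κ * (u j)⁻¹)
    (fun h i => (hfan h i).le) t [] i zero_le_one
  have h2 := le_expPayoffFrom (τ := τ) (σ := g.toStrategy) hr.le (v := fun j => κ * (u j)⁻¹)
    (fun h i => (hfan h i).ge) t [] i zero_le_one
  rw [one_mul] at h1 h2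
  exact le_antisymm h1 h2

theorem isOptimalDiscounted_limiting {r κ : ℝ} (hr : 0 < r) (hκ : 0 < κ) {u β : V → ℝ}
    (hu : ∀ i, 0 < u i) (hMu : (propMatrix G).mulVec u = r • u) (hβ : ∀ i, β i ∈ Icc (0 : ℝ) 1)
    {c : PositionalChooser G} (hc : IsLimitingChooser u c)
    {g : PositionalGuesser G} (hg : IsLimitingGuesser u β g)
    (hlim : ∀ i, Tendsto
      (fun t : ℕ => (r ^ t)⁻¹ * (propMatrix G ^ t).mulVec (fun j => u j ^ 2) i) atTop
      (𝓝 (κ * u i))) :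
    IsOptimalDiscounted r (fun i => κ * (u i)⁻¹) c g := by
  refine ⟨hr, fun i => mul_pos hκ (inv_pos.2 (hu i)),
    fun i => tendsto_expFortune_limiting hr hu hMu hβ hc hg (hlim i), fun i x hx y hy => ?_⟩
  exact (fanPayoff_limitingChooser_le hr hκ hu hMu hc i hy.1 hy.2).trans
    (fanPayoff_limitingGuesser_eq hr hu hMu hβ hg i hx).ge

lemma isSaddlePointOn_expPayoff {r κ : ℝ} (hr : 0 < r) (hκ : 0 < κ) {u β : V → ℝ}
    (hu : ∀ i, 0 < u i) (hMu : (propMatrix G).mulVec u = r • u) (hβ : ∀ i, β i ∈ Icc (0 : ℝ) 1)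
    {c : PositionalChooser G} (hc : IsLimitingChooser u c)
    {g : PositionalGuesser G} (hg : IsLimitingGuesser u β g) (s : ℕ) (i : V) :
    IsSaddlePointOn univ univ
      (fun τ σ => r ^ s * expPayoff τ σ (fun j => κ * (u j)⁻¹) s i)
      c.toStrategy g.toStrategy := fun τ _ σ _ =>
  (expPayoff_limitingChooser_le hr hκ hu hMu hc σ s i).trans
    (expPayoff_limitingGuesser_eq hr hu hMu hβ hg τ s i).ge

/-- The growth rates of the expected fortune have the value `1 / r`, since the node values are
bounded between positive constants. -/
theorem growth_limiting {r κ : ℝ} (hr : 0 < r) (hκ : 0 < κ) {u β : V → ℝ}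
    (hu : ∀ i, 0 < u i) (hMu : (propMatrix G).mulVec u = r • u) (hβ : ∀ i, β i ∈ Icc (0 : ℝ) 1)
    {c : PositionalChooser G} (hc : IsLimitingChooser u c)
    {g : PositionalGuesser G} (hg : IsLimitingGuesser u β g) (i : V) :
    IsSaddlePointOn univ univ (upperGrowth i) c.toStrategy g.toStrategy ∧
    IsSaddlePointOn univ univ (lowerGrowth i) c.toStrategy g.toStrategy ∧
    upperGrowth i c.toStrategy g.toStrategy = ENNReal.ofReal r⁻¹ ∧
    lowerGrowth i c.toStrategy g.toStrategy = ENNReal.ofReal r⁻¹ := by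
  have hv : ∀ i, 0 < κ * (u i)⁻¹ := fun i => mul_pos hκ (inv_pos.2 (hu i))
  have hup : ∀ σ, upperGrowth i c.toStrategy σ ≤ ENNReal.ofReal r⁻¹ := fun σ =>
    upperGrowth_le hr hv fun t => expPayoff_limitingChooser_le hr hκ hu hMu hc σ t i
  have hlow : ∀ τ, ENNReal.ofReal r⁻¹ ≤ lowerGrowth i τ g.toStrategy := fun τ =>
    le_lowerGrowth hr hv fun t => (expPayoff_limitingGuesser_eq hr hu hMu hβ hg τ t i).ge
  have hlu := lowerGrowth_le_upperGrowth (G := G) i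
  exact ⟨fun τ _ σ _ => (hup σ).trans ((hlow τ).trans (hlu _ _)),
    fun τ _ σ _ => ((hlu _ _).trans (hup σ)).trans (hlow τ),
    le_antisymm (hup _) ((hlow _).trans (hlu _ _)),
    le_antisymm ((hlu _ _).trans (hup _)) (hlow _)⟩

/-! ### Uniqueness -/

/-- The value of an optimal pair at a node is the value of its one-round game. -/
lemma IsOptimalDiscounted.fanPayoff_eq_value {d : ℝ} {v : V → ℝ} {c : PositionalChooser G}
    {g : PositionalGuesser G} (h : IsOptimalDiscounted d v c g) (i : V) :
    fanPayoff G i (fun k => d * v k) (c.prob i) (g.prob i, g.wager i) = v i := by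
  obtain ⟨-, -, hlim, -⟩ := h
  refine tendsto_nhds_unique ?_ ((hlim i).comp (tendsto_add_atTop_nat 1))
  rw [fanPayoff_eq (g.isMove i).2.2]
  have h1 : Tendsto (fun t : ℕ => ∑ k, c.prob i k *
      (d * (d ^ t * expFortune c.toStrategy g.toStrategy t k)) *
      (1 - g.wager i + payoffFactor G i * g.wager i * g.prob i k)) atTop
      (𝓝 (∑ k, c.prob i k * (d * v k) *
        (1 - g.wager i + payoffFactor G i * g.wager i * g.prob i k))) :=
    tendsto_finsetSum _ fun k _ => (((hlim k).const_mul d).const_mul _).mul_const _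
  refine h1.congr fun t => ?_
  rw [Function.comp, expFortune, expPayoff_positional_succ, fanPayoff_eq (g.isMove i).2.2,
    Finset.mul_sum]
  refine Finset.sum_congr rfl fun k _ => ?_
  rw [expFortune, pow_succ]
  ring

/-- The reciprocals of the node values of an optimal pair form an eigenvector of the propagation
matrix, with the discount factor as eigenvalue. -/
lemma IsOptimalDiscounted.propMatrix_mulVec_inv {d : ℝ} {v : V → ℝ} {c : PositionalChooser G}
    {g : PositionalGuesser G} (h : IsOptimalDiscounted d v c g) (hG : ∀ i, ∃ j, G.Adj i j) :
    (propMatrix G).mulVec (fun i => (v i)⁻¹) = d • fun i => (v i)⁻¹ := by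
  have hval := h.fanPayoff_eq_value
  obtain ⟨hd, hv, -, hs⟩ := h
  funext i
  obtain ⟨j, hj⟩ := hG i
  have hf := (fan_saddlePoint_unique (hG i) (fun k => mul_pos hd (hv k)) (c.isMove i) (g.isMove i)
    (g.wager_mem i) (hs i) rfl).1
  rw [hval] at hf
  have hS : (∑ k ∈ Finset.univ.filter (fun k => G.Adj i k), (d * v k)⁻¹) =
      d⁻¹ * ∑ k ∈ Finset.univ.filter (fun k => G.Adj i k), (v k)⁻¹ := by
    rw [Finset.mul_sum]
    exact Finset.sum_congr rfl fun k _ => mul_inv _ _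
  have hN := (payoffFactor_pos hj).ne'
  have hS0 : 0 < ∑ k ∈ Finset.univ.filter (fun k => G.Adj i k), (v k)⁻¹ :=
    Finset.sum_pos (fun k _ => inv_pos.2 (hv k)) ⟨j, by simp [hj]⟩
  rw [propMatrix_mulVec, Pi.smul_apply, smul_eq_mul, hf, hS]
  have := hS0.ne'
  field_simp

/-- A pair of strategies that is optimal with node values inversely proportional to `u` consists of
limiting strategies. -/
lemma IsOptimalDiscounted.isLimiting {r : ℝ} {u : V → ℝ} (hu : ∀ i, 0 < u i)
    (hMu : (propMatrix G).mulVec u = r • u) (hG : ∀ i, ∃ j, G.Adj i j) {v : V → ℝ} {b : ℝ}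
    (hb : 0 < b) (hvu : ∀ i, (v i)⁻¹ = b * u i) {c : PositionalChooser G}
    {g : PositionalGuesser G} (h : IsOptimalDiscounted r v c g) :
    IsLimitingChooser u c ∧
      ∃ β : V → ℝ, (∀ i, β i ∈ Icc (0 : ℝ) 1) ∧ IsLimitingGuesser u β g := by
  obtain ⟨hr, hv, -, hs⟩ := h
  have hf := fun i => fan_saddlePoint_unique (hG i) (fun k => mul_pos hr (hv k)) (c.isMove i)
    (g.isMove i) (g.wager_mem i) (hs i) rfl
  have hc : IsLimitingChooser u c := by
    intro i j
    by_cases hj : G.Adj i j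
    swap
    · rw [(c.isMove i).2.1 j hj, limitingProb, if_neg hj]
    have hN := payoffFactor_pos hj
    have hS : (∑ k ∈ Finset.univ.filter (fun k => G.Adj i k), (r * v k)⁻¹) =
        r⁻¹ * b * (payoffFactor G i * (r * u i)) := by
      rw [← sum_adj_eq hMu hj, Finset.mul_sum]
      exact Finset.sum_congr rfl fun k _ => by rw [mul_inv, hvu, mul_assoc]
    have h1 := payoffFactor_mul_limitingProb hr hu hMu hj
    have hui := (hu i).ne'
    refine mul_left_cancel₀ hN.ne' ?_
    rw [(hf i).2.1 j hj, hS, mul_inv, hvu, h1]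
    field_simp
  have hmin := fun i => limitingProbMin_pos hr hu hMu (hG i)
  have hmul : ∀ i, 2 ≤ outDeg G i → ∀ k, G.Adj i k →
      1 - g.wager i + outDeg G i * g.wager i * g.prob i k = outDeg G i * limitingProb G u i k := by
    intro i hi k hk
    rw [← payoffFactor_of_two_le hi, (hf i).2.2.2 k hk, hc]
  -- the parameter is determined by `w = 1 - n β c_min`
  set β : V → ℝ := fun i => if outDeg G i = 1 then 0 else
    (1 - g.wager i) / (outDeg G i * limitingProbMin G u i) with hβ
  have hβw : ∀ i, 2 ≤ outDeg G i →
      (outDeg G i : ℝ) * β i * limitingProbMin G u i = 1 - g.wager i := by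
    intro i hi
    have hn : (outDeg G i : ℝ) ≠ 0 := by
      have : outDeg G i ≠ 0 := by omega
      exact_mod_cast this
    have := (hmin i).ne'
    simp only [hβ, if_neg (show outDeg G i ≠ 1 by omega)]
    field_simp
  refine ⟨hc, β, fun i => ?_, fun i => ⟨fun h1 => ⟨(hf i).2.2.1 h1, fun j hj =>
    (g.isMove i).eq_one_of_outDeg_eq_one h1 hj⟩, fun h2 => ⟨by rw [hβw i h2]; ring,
    fun h0 j hj => ?_⟩⟩⟩
  · by_cases h1 : outDeg G i = 1
    · simp [hβ, h1]
    obtain ⟨j, hj, hjm⟩ := exists_limitingProb_eq_min u (hG i)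
    have h2 := two_le_outDeg hj h1
    have hn : (0 : ℝ) < outDeg G i := by exact_mod_cast outDeg_pos hj
    simp only [hβ, if_neg h1]
    refine ⟨div_nonneg (sub_nonneg.2 (g.wager_mem i).2) (mul_pos hn (hmin i)).le,
      (div_le_one (mul_pos hn (hmin i))).2 ?_⟩
    have h3 := hmul i h2 j hj
    rw [hjm] at h3
    have h4 := mul_nonneg (mul_nonneg hn.le (g.wager_mem i).1) ((g.isMove i).1 j)
    linarith
  · have hn : (0 : ℝ) < outDeg G i := by exact_mod_cast outDeg_pos hj
    have h3 := hmul i h2 j hj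
    have h4 := hβw i h2
    rw [h4, sub_sub_cancel, eq_div_iff h0]
    refine mul_left_cancel₀ hn.ne' ?_
    linarith

end PathGame

theorem mainTheorem2 {V : Type*} [Fintype V] [DecidableEq V] (G : Digraph V) [DecidableRel G.Adj]
    (hconn : PathGame.StronglyConnected G) (haper : PathGame.Aperiodic G) :
    ∃ (r : ℝ) (u : V → ℝ) (κ : ℝ),
      -- the maximal eigenvalue and the limiting reciprocal values
      (PathGame.propMatrix G).IsPrimitive ∧
      PathGame.IsMaximalEigenvalue (PathGame.propMatrix G) r ∧
      Tendsto (fun s : ℕ => (r ^ s)⁻¹ • ((PathGame.propMatrix G ^ s).mulVec (fun _ => (1 : ℝ))))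
        atTop (𝓝 u) ∧
      (∀ i, 0 < u i) ∧
      (PathGame.propMatrix G).mulVec u = r • u ∧
      (∀ (z : ℝ) (x : V → ℝ), (∀ i, 0 < x i) → (PathGame.propMatrix G).mulVec x = z • x →
        z = r ∧ ∃ a : ℝ, 0 < a ∧ x = a • u) ∧
      0 < κ ∧
      -- the limiting strategies exist; the transition matrix is similar to the propagation matrix
      (∃ c : PathGame.PositionalChooser G, PathGame.IsLimitingChooser u c) ∧
      Matrix.of (PathGame.limitingProb G u) =
        r⁻¹ • (Matrix.diagonal (fun i => (u i)⁻¹) * PathGame.propMatrix G * Matrix.diagonal u) ∧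
      (∀ β : V → ℝ, (∀ i, β i ∈ Icc (0 : ℝ) 1) →
        ∃ g : PathGame.PositionalGuesser G, PathGame.IsLimitingGuesser u β g) ∧
      -- the limiting strategies are optimal
      (∀ (c : PathGame.PositionalChooser G) (g : PathGame.PositionalGuesser G) (β : V → ℝ),
        (∀ i, β i ∈ Icc (0 : ℝ) 1) →
        PathGame.IsLimitingChooser u c → PathGame.IsLimitingGuesser u β g →
        -- in the discounted game, with values `κ / u`
        PathGame.IsOptimalDiscounted r (fun i => κ * (u i)⁻¹) c g ∧
        -- against all strategies, in each discounted game that is stopped after `s` rounds and in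
        -- which the Guesser's fortune is then multiplied by the value of the final node
        (∀ (s : ℕ) (i : V),
          IsSaddlePointOn univ univ
            (fun τ σ => r ^ s * PathGame.expPayoff τ σ (fun j => κ * (u j)⁻¹) s i)
            c.toStrategy g.toStrategy ∧
          r ^ s * PathGame.expPayoff c.toStrategy g.toStrategy (fun j => κ * (u j)⁻¹) s i =
            κ * (u i)⁻¹) ∧
        -- against all strategies, for the growth rate of the undiscounted expected fortune
        (∀ i : V,
          IsSaddlePointOn univ univ (PathGame.upperGrowth i) c.toStrategy g.toStrategy ∧
          IsSaddlePointOn univ univ (PathGame.lowerGrowth i) c.toStrategy g.toStrategy ∧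
          PathGame.upperGrowth i c.toStrategy g.toStrategy = ENNReal.ofReal r⁻¹ ∧
          PathGame.lowerGrowth i c.toStrategy g.toStrategy = ENNReal.ofReal r⁻¹)) ∧
      -- uniqueness of the discount factor, of the optimal values and of the optimal strategies
      (∀ (c : PathGame.PositionalChooser G) (g : PathGame.PositionalGuesser G)
        (d : ℝ) (v : V → ℝ), PathGame.IsOptimalDiscounted d v c g →
        d = r ∧ (∀ i, v i = κ * (u i)⁻¹) ∧ PathGame.IsLimitingChooser u c ∧
        ∃ β : V → ℝ, (∀ i, β i ∈ Icc (0 : ℝ) 1) ∧ PathGame.IsLimitingGuesser u β g) := by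
  have hne : Nonempty V := PathGame.nonempty_of_aperiodic haper
  have hG := PathGame.exists_adj hconn haper
  have hprim := PathGame.propMatrix_isPrimitive hconn haper
  obtain ⟨r, x, hr, hx, hMx⟩ := hprim.exists_pos_eigenvector
  obtain ⟨l, hl, hlpos⟩ := hprim.tendsto_pow_mulVec hr hx hMx (fun _ => 1)
  have hl0 : 0 < l := hlpos fun _ => one_pos
  -- `u` is the multiple of the Perron eigenvector picked out by the constant vector `1`
  set u : V → ℝ := fun i => l * x i with hudef
  have hu : ∀ i, 0 < u i := fun i => mul_pos hl0 (hx i)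
  have hMu : (PathGame.propMatrix G).mulVec u = r • u := by
    have : u = l • x := rfl
    rw [this, Matrix.mulVec_smul, hMx, smul_comm]
  -- `κ` is the limiting coefficient of the vector of squares of `u`
  obtain ⟨κ, hκ, hκpos⟩ := hprim.tendsto_pow_mulVec hr hu hMu (fun i => u i ^ 2)
  have hκ0 : 0 < κ := hκpos fun i => pow_pos (hu i) 2
  have hchooser : ∃ c : PathGame.PositionalChooser G, PathGame.IsLimitingChooser u c :=
    ⟨⟨PathGame.limitingProb G u, PathGame.isMove_limitingProb hr hu hMu⟩, fun _ _ => rfl⟩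
  refine ⟨r, u, κ, hprim, hprim.isMaximalEigenvalue hr hx hMx, tendsto_pi_nhds.2 hl, hu, hMu,
    fun z y hy hMy => hprim.eigenvector_unique hr hu hMu hy hMy, hκ0, hchooser, ?_,
    fun β hβ => PathGame.exists_isLimitingGuesser hr hu hMu hG hβ,
    fun c g β hβ hc hg => ⟨PathGame.isOptimalDiscounted_limiting hr hκ0 hu hMu hβ hc hg hκ,
      fun s i => ⟨PathGame.isSaddlePointOn_expPayoff hr hκ0 hu hMu hβ hc hg s i,
        PathGame.expPayoff_limitingGuesser_eq hr hu hMu hβ hg _ s i⟩,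
      PathGame.growth_limiting hr hκ0 hu hMu hβ hc hg⟩,
    fun c g d v h => ?_⟩
  · ext i j
    rw [Matrix.of_apply, PathGame.limitingProb_eq hr hu hMu, Matrix.smul_apply,
      Matrix.mul_diagonal, Matrix.diagonal_mul, smul_eq_mul]
    have := (hu i).ne'
    field_simp
  · obtain ⟨rfl, b, hb, hvu⟩ := hprim.eigenvector_unique hr hu hMu
      (fun i => inv_pos.2 (h.2.1 i)) (h.propMatrix_mulVec_inv hG)
    obtain ⟨hc, β, hβ, hg⟩ := h.isLimiting hu hMu hG hb (congrFun hvu)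
    exact ⟨rfl, fun i => tendsto_nhds_unique (h.2.2.1 i)
      (PathGame.tendsto_expFortune_limiting hr hu hMu hβ hc hg (hκ i)), hc, β, hβ, hg⟩
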